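/- Let $r\ge 1$, $n\ge 0$, let $\mathfrak g=sl_{r+1}$ over $\mathbb C$ with its diagonal Cartan subalgebra $\mathfrak h$, the strictly upper triangular subalgebra $\mathfrak n_+$, and $h_i=E_{i,i}-E_{i+1,i+1}\in\mathfrak h$ ($1\le i\le r$). A $\mathfrak g$-module $V$ is called integrable if there is a finite set $D$ of integral weights (i.e. weights $\mu\in\mathfrak h^*$ with all $\mu(h_i)\in\mathbb Z$) such that $V=\bigoplus_{\mu\in D}V^\mu$, where $V^\mu=\{v : hv=\mu(h)v \text{ for all } h\in\mathfrak h\}$. Let $M=\mathbb C$, so that $A=\mathbb C[x]$. The local Weyl module $W=W_{\mathbb C}(\{0\}_{n\omega_1})$ is the maximal $\mathfrak g\otimes 1$-integrable $\mathfrak g\otimes A$-module generated by a vector $w$ such that, for all $P\in A$, $$(\mathfrak n_+\otimes P)\,w=0,\qquad (h_1\otimes P)\,w=n\,P(0)\,w,\qquad (h_i\otimes P)\,w=0\quad(2\le i\le r);$$ maximal means that for every $\mathfrak g\otimes 1$-integrable $\mathfrak g\otimes A$-module $V$ generated by a vector $v$ with these properties there is a surjective homomorphism of $\mathfrak g\otimes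 A$-modules $W\to V$ taking $w$ to $v$. Proposition (one-dimensional case). The module $W$ exists: it is $U(\mathfrak g\otimes A)/I$, where $I$ is the intersection of all left ideals $J$ such that $U(\mathfrak g\otimes A)/J$ is $\mathfrak g\otimes 1$-integrable and the class of $1$ has the properties required of $w$. It is finite-dimensional, and $$\dim W=(r+1)^n .$$ For all integers $i_0,\dots,i_r\ge 0$ with $i_0+\dots+i_r=n$, the weight space of $W$ of the weight $\mu$ with $\mu(h_j)=i_{j-1}-i_j$ ($1\le j\le r$) satisfies $$\dim W^{(i_0-i_1,\,i_1-i_2,\,\dots,\,i_{r-1}-i_r)}=\frac{n!}{i_0!\,i_1!\cdots i_r!}.$$ -/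

import Mathlib

open scoped TensorProduct Polynomial

universe u

namespace WeylModule

open LieAlgebra.SpecialLinear

/-- The current Lie algebra `sl_{r+1} ⊗ A` over `ℂ`; the element `x ⊗ P` of the usual notation is
written `P ⊗ₜ x` here. -/
abbrev Current (r : ℕ) (A : Type) [CommRing A] [Algebra ℂ A] : Type :=
  A ⊗[ℂ] (sl (Fin (r + 1)) ℂ)

/-- The Chevalley generators `h_1, …, h_r`, a basis of the diagonal Cartan subalgebra:
`h_i` is the diagonal matrix with `1` and `-1` in two consecutive places (indices from `0`). -/
def coroot {r : ℕ} (i : Fin r) : sl (Fin (r + 1)) ℂ :=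
  singleSubSingle i.castSucc i.succ 1

/-- The matrix unit `e_{ij}` with `i < j`; these elements span the subalgebra `n₊` of strictly
upper triangular matrices. -/
def posRoot {r : ℕ} (i j : Fin (r + 1)) (h : i < j) : sl (Fin (r + 1)) ℂ :=
  single i j h.ne 1

section Modules

variable (r : ℕ) (A : Type) [CommRing A] [Algebra ℂ A]
  (V : Type u) [AddCommGroup V] [Module ℂ V]
  [LieRingModule (Current r A) V] [LieModule ℂ (Current r A) V]

/-- The weight space `V^μ` for the action of `h ⊗ 1`. An integral weight `μ` is given by
its coordinates `μ_i = μ(h_i)`. -/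
def weightSpace (μ : Fin r → ℤ) : Submodule ℂ V where
  carrier := {v | ∀ i, ⁅((1 : A) ⊗ₜ[ℂ] coroot i : Current r A), v⁆ = (μ i : ℂ) • v}
  add_mem' := by
    intro v w hv hw i
    rw [lie_add, hv i, hw i, smul_add]
  zero_mem' := by
    intro i
    rw [lie_zero, smul_zero]
  smul_mem' := by
    intro c v hv i
    rw [lie_smul, hv i, smul_comm]

/-- Integrability over `sl_{r+1} ⊗ 1`: the module is the direct sum of its weight spaces over
a finite set of integral weights. The weight spaces may be infinite-dimensional. -/
def IsIntegrable : Prop :=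
  ∃ D : Finset (Fin r → ℤ), DirectSum.IsInternal fun μ : D => weightSpace r A V μ.1

variable {r A}

/-- Let `Z` be a family of `r` multisets of points of `Spec A` (algebra homomorphisms `A → ℂ`), that
is a `λ`-multiset with `λ_i = card (Z i)`. The module `V` is integrable over `sl_{r+1} ⊗ 1` and
is generated by the vector `v` with `(n₊ ⊗ P) v = 0` and
`(h_i ⊗ P) v = (∑_{z ∈ Z i} P(z)) v` for all `P`. -/
structure IsHighestWeight (Z : Fin r → Multiset (A →ₐ[ℂ] ℂ)) (v : V) : Prop where
  integrable : IsIntegrable r A V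
  generates : LieSubmodule.lieSpan ℂ (Current r A) {v} = ⊤
  raising : ∀ (i j : Fin (r + 1)) (h : i < j) (P : A),
    ⁅(P ⊗ₜ[ℂ] posRoot i j h : Current r A), v⁆ = 0
  cartan : ∀ (i : Fin r) (P : A),
    ⁅(P ⊗ₜ[ℂ] coroot i : Current r A), v⁆ = ((Z i).map fun z => z P).sum • v

end Modules

/-- `W`, with the vector `w`, is the maximal module in `IsHighestWeight`: every other such
module (in the universe `u`) is a quotient of it. -/
structure IsLocalWeylModule {r : ℕ} {A : Type} [CommRing A] [Algebra ℂ A]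
    (Z : Fin r → Multiset (A →ₐ[ℂ] ℂ))
    (W : Type) [AddCommGroup W] [Module ℂ W] [LieRingModule (Current r A) W]
    [LieModule ℂ (Current r A) W] (w : W) : Prop where
  isHighestWeight : IsHighestWeight W Z w
  maximal : ∀ (V : Type u) [AddCommGroup V] [Module ℂ V] [LieRingModule (Current r A) V]
    [LieModule ℂ (Current r A) V] (v : V), IsHighestWeight V Z v →
      ∃ φ : W →ₗ⁅ℂ, Current r A⁆ V, Function.Surjective φ ∧ φ w = v

section Construction

variable {r : ℕ} {A : Type} [CommRing A] [Algebra ℂ A]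

variable (r A) in
/-- The universal enveloping algebra of `sl_{r+1} ⊗ A`. -/
abbrev Env : Type := UniversalEnvelopingAlgebra ℂ (Current r A)

/-- The cyclic module `U(sl_{r+1} ⊗ A) / J` of a left ideal `J`. -/
def Cyclic (J : Ideal (Env r A)) : Type := Env r A ⧸ J

variable (J : Ideal (Env r A))

noncomputable instance : AddCommGroup (Cyclic J) := inferInstanceAs (AddCommGroup (Env r A ⧸ J))

noncomputable instance : Module (Env r A) (Cyclic J) :=
  inferInstanceAs (Module (Env r A) (Env r A ⧸ J))

noncomputable instance : Module ℂ (Cyclic J) := inferInstanceAs (Module ℂ (Env r A ⧸ J))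

instance : IsScalarTower ℂ (Env r A) (Cyclic J) :=
  inferInstanceAs (IsScalarTower ℂ (Env r A) (Env r A ⧸ J))

/-- The class of `1`. -/
def Cyclic.vec : Cyclic J := Submodule.Quotient.mk (1 : Env r A)

attribute [local instance 100] LieRing.ofAssociativeRing

noncomputable instance : LieRingModule (Current r A) (Cyclic J) where
  bracket x m := UniversalEnvelopingAlgebra.ι ℂ x • m
  add_lie x y m := by
    change UniversalEnvelopingAlgebra.ι ℂ (x + y) • m = _
    rw [map_add, add_smul]
  lie_add x m m' := smul_add _ m m'
  leibniz_lie x y m := by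
    change _ = UniversalEnvelopingAlgebra.ι ℂ ⁅x, y⁆ • m + _
    rw [LieHom.map_lie, LieRing.of_associative_ring_bracket, sub_smul, mul_smul, mul_smul]
    abel

theorem Cyclic.lie_def (x : Current r A) (m : Cyclic J) :
    ⁅x, m⁆ = UniversalEnvelopingAlgebra.ι ℂ x • m := rfl

instance : LieModule ℂ (Current r A) (Cyclic J) where
  smul_lie c x m := by
    rw [Cyclic.lie_def, Cyclic.lie_def, map_smul, smul_assoc]
  lie_smul c x m := by
    rw [Cyclic.lie_def, Cyclic.lie_def, smul_algebra_smul_comm]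

/-- The intersection of all left ideals `J` such that `U / J`, with the class of `1`, is an
integrable module with the highest weight vector of the required kind. -/
noncomputable def localWeylIdeal (Z : Fin r → Multiset (A →ₐ[ℂ] ℂ)) : Ideal (Env r A) :=
  sInf {J | IsHighestWeight (Cyclic J) Z (Cyclic.vec J)}

/-- The local Weyl module `W_M(Z)` of `sl_{r+1} ⊗ A`, where `M = Spec A`. -/
abbrev LocalWeyl (Z : Fin r → Multiset (A →ₐ[ℂ] ℂ)) : Type := Cyclic (localWeylIdeal Z)

/-- The generating vector of the local Weyl module. -/
noncomputable abbrev LocalWeyl.vec (Z : Fin r → Multiset (A →ₐ[ℂ] ℂ)) : LocalWeyl Z :=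
  Cyclic.vec (localWeylIdeal Z)

end Construction

/-- The `n ω_1`-multiset `{0}` on the affine line: `n` copies of the origin at the first node of the
Dynkin diagram (it has index `0` in `Fin r`) and no points at the other nodes. -/
noncomputable def origin (r n : ℕ) (i : Fin r) : Multiset (ℂ[X] →ₐ[ℂ] ℂ) :=
  if (i : ℕ) = 0 then Multiset.replicate n (Polynomial.aeval (0 : ℂ)) else 0

end WeylModule

/-! The bound `dim ≤ (r+1)^n` holds for every integrable module generated by a vector `v` of the
required kind; equality comes from one explicit module of that dimension.

Upper bound. Letting the identity matrix times `P` act by `n P(0)` extends the action to `gl_{r+1} ⊗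
ℂ[X]`, and then `E_{ab} ⊗ P` kills `v` for all `b ≠ 0`. Divided powers of the `E_{j0} ⊗ 1` applied
to `v` give vectors `v_ν`, `|ν| = n`, that satisfy the relations of symmetrized tensors. Hence the
module is the sum of the orbits of the `v_ν` under the commutative algebra generated by the `E_{aa}
⊗ x^i`, `i ≥ 1` (`mem_iSup_cartanOrbit`). Regard these operators as the power sums of an `a`-th
alphabet, with elementary symmetric functions `e_{a,k}`. Then `∏_a ∑_k e_{a,k} T^k = 1`, since `∑_a
E_{aa} ⊗ x^i` acts by `0`, and `e_{a,k} v_ν = 0` for `k > ν_a` (`exists_newtonE_smul`). These are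
the relations of the cohomology ring of a partial flag variety, so each orbit has dimension at most
a multinomial coefficient (`exists_finset_span_of_prod_eq_one`); the sum of these is `(r+1)^n`.

Lower bound. Over `ℂ[t]`, take the tensor product of the evaluation modules `ℂ^{r+1}` at the points
`0, t, …, (n-1)t`. The highest weight vector generates a lattice of full rank `(r+1)^n`, because the
points are distinct for generic `t` (`finrank_modelLattice`). The fibre of the lattice at `t = 0`,
where the points collide, is a cyclic module of the required kind.

Conclusion. Intersecting its ideal with any admissible `J` and comparing dimensions gives
`modelIdeal_le`, so `I` is the ideal of the model. Equality in the total dimension forces equality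
for each orbit, and the orbits are the weight spaces. -/

namespace WeylModule

open LieAlgebra.SpecialLinear

/-! ### Multinomial coefficients. -/

section Combinatorics

variable {ι : Type*} [Fintype ι] [DecidableEq ι]

theorem sum_update_pred {ν : ι → ℕ} {a : ι} (ha : ν a ≠ 0) :
    ∑ b, Function.update ν a (ν a - 1) b + 1 = ∑ b, ν b := by
  rw [Finset.sum_update_of_mem (Finset.mem_univ a), ← Finset.add_sum_erase _ ν (Finset.mem_univ a),
    Finset.sdiff_singleton_eq_erase]
  omega

theorem prod_factorial_update_pred {ν : ι → ℕ} {a : ι} (ha : ν a ≠ 0) :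
    ν a * ∏ b, (Function.update ν a (ν a - 1) b).factorial = ∏ b, (ν b).factorial := by
  rw [← Finset.mul_prod_erase _ _ (Finset.mem_univ a),
    ← Finset.mul_prod_erase _ (fun b => (ν b).factorial) (Finset.mem_univ a), ← mul_assoc,
    Function.update_self, Nat.mul_factorial_pred ha]
  congr 1
  refine Finset.prod_congr rfl fun b hb => ?_
  rw [Function.update_of_ne (Finset.ne_of_mem_erase hb)]

/-- Pascal's rule for multinomial coefficients. -/
theorem multinomial_eq_sum_update (ν : ι → ℕ) (h : ∑ a, ν a ≠ 0) :
    Nat.multinomial Finset.univ ν = ∑ a, if ν a = 0 then 0 else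
      Nat.multinomial Finset.univ (Function.update ν a (ν a - 1)) := by
  have hpos : 0 < ∏ b, (ν b).factorial := Finset.prod_pos fun b _ => Nat.factorial_pos _
  refine Nat.eq_of_mul_eq_mul_left hpos ?_
  rw [Nat.multinomial_spec, Finset.mul_sum, ← Nat.mul_factorial_pred h, Finset.sum_mul]
  refine Finset.sum_congr rfl fun a _ => ?_
  split_ifs with ha
  · simp [ha]
  · rw [← prod_factorial_update_pred ha, mul_assoc, Nat.multinomial_spec,
      ← sum_update_pred ha, Nat.add_sub_cancel]

end Combinatorics

/-! ### Dimension bound for cyclic modules over the algebra of a partial flag variety. -/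

section CyclicBound

variable {ι K R M : Type*} [Fintype ι] [DecidableEq ι] [CommRing K] [CommRing R] [Algebra K R]
  [AddCommGroup M] [Module K M] [Module R M] [IsScalarTower K R M]

/-- The coefficient of `T^{|ν|}` in the product is `0`. Every exponent family of the same total
other than `ν` exceeds `ν` somewhere, so all other terms of this coefficient send `m` into `N`. -/
theorem prod_smul_mem_of_prod_eq_one {e : ι → ℕ → R}
    (hprod : ∏ a, PowerSeries.mk (e a) = 1) {ν : ι → ℕ} (hν : ∑ a, ν a ≠ 0)
    {N : Submodule R M} {m : M} (hm : ∀ a k, ν a < k → e a k • m ∈ N) :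
    (∏ a, e a (ν a)) • m ∈ N := by
  have h := congrArg (PowerSeries.coeff (∑ a, ν a)) hprod
  rw [PowerSeries.coeff_prod, PowerSeries.coeff_one, if_neg hν] at h
  simp only [PowerSeries.coeff_mk] at h
  have hmem : Finsupp.equivFunOnFinite.symm ν ∈ Finset.finsuppAntidiag Finset.univ (∑ a, ν a) := by
    simp [Finset.mem_finsuppAntidiag]
  rw [← Finset.add_sum_erase _ _ hmem] at h
  have h2 := eq_neg_of_add_eq_zero_left h
  simp only [Finsupp.equivFunOnFinite_symm_apply_apply] at h2
  rw [h2, neg_smul, Finset.sum_smul]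
  refine N.neg_mem (N.sum_mem fun f hf => ?_)
  obtain ⟨hne, hf⟩ := Finset.mem_erase.1 hf
  rw [Finset.mem_finsuppAntidiag] at hf
  obtain ⟨a, ha⟩ : ∃ a, ν a < f a := by
    by_contra! hle
    refine hne (Finsupp.ext fun a => ?_)
    exact (Finset.sum_eq_sum_iff_of_le fun a _ => hle a).1 hf.1 a (Finset.mem_univ a)
  rw [← Finset.prod_erase_mul _ _ (Finset.mem_univ a), mul_smul]
  exact N.smul_mem _ (hm a _ ha)

/-- A cyclic module over the ring generated by the coefficients of power series with product `1`
is spanned by a multinomial coefficient of vectors, if the series act on the generator as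
polynomials of the given degrees. -/
theorem exists_finset_span_of_prod_eq_one {e : ι → ℕ → R} (h0 : ∀ a, e a 0 = 1)
    (hprod : ∏ a, PowerSeries.mk (e a) = 1)
    (hgen : Algebra.adjoin K {x | ∃ a k, e a (k + 1) = x} = ⊤) (n : ℕ) :
    ∀ (ν : ι → ℕ), ∑ a, ν a = n → ∀ (N : Submodule R M) (m : M),
      (∀ a k, ν a < k → e a k • m ∈ N) →
      ∃ s : Finset M, s.card ≤ Nat.multinomial Finset.univ ν ∧
        ∀ x : R, x • m ∈ Submodule.span K (s : Set M) ⊔ N.restrictScalars K := by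
  classical
  induction n with
  | zero =>
    intro ν hν N m hm
    refine ⟨{m}, by simpa using Nat.succ_le_of_lt (Nat.multinomial_pos _ _), fun x => ?_⟩
    have hx : x ∈ Algebra.adjoin K {x | ∃ a k, e a (k + 1) = x} := hgen ▸ Algebra.mem_top
    -- For `ν = 0` every generator sends `m` into `N`, so the cyclic module is one-dimensional
    -- modulo `N`.
    suffices h : ∃ c : K, x • m - c • m ∈ N by
      obtain ⟨c, hc⟩ := h
      rw [← add_sub_cancel (c • m) (x • m)]
      exact Submodule.add_mem_sup (Submodule.smul_mem _ c (Submodule.subset_span (by simp))) hc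
    induction hx using Algebra.adjoin_induction with
    | mem x hx =>
      obtain ⟨a, k, rfl⟩ := hx
      refine ⟨0, ?_⟩
      rw [zero_smul, sub_zero]
      refine hm a _ ?_
      rw [Finset.sum_eq_zero_iff] at hν
      rw [hν a (Finset.mem_univ a)]
      exact Nat.succ_pos k
    | algebraMap c => exact ⟨c, by simp⟩
    | add x y _ _ hx hy =>
      obtain ⟨c, hc⟩ := hx
      obtain ⟨d, hd⟩ := hy
      exact ⟨c + d, by simpa only [add_smul, add_sub_add_comm] using N.add_mem hc hd⟩
    | mul x y _ _ hx hy =>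
      obtain ⟨c, hc⟩ := hx
      obtain ⟨d, hd⟩ := hy
      refine ⟨d * c, ?_⟩
      have h : (x * y) • m - (d * c) • m = x • (y • m - d • m) + d • (x • m - c • m) := by
        rw [smul_sub, smul_sub, mul_smul, mul_smul, ← algebraMap_smul R d (x • m),
          ← algebraMap_smul R d m, smul_comm x (algebraMap K R d) m, algebraMap_smul]
        abel
      rw [h]
      refine N.add_mem (N.smul_mem _ hd) ?_
      rw [← algebraMap_smul R d]
      exact N.smul_mem _ hc
  | succ n ih =>
    intro ν hν N m hm
    -- Filter `R m` by the submodules generated by `m_S = (∏ a ∈ S, e a (ν a)) • m` modulo `N`.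
    -- Passing from `S` to `S ∪ {a}` puts `e a (ν a) • m_S` into the smaller submodule, so the
    -- quotient satisfies the hypothesis with `ν a` lowered by one; for `ν a = 0` nothing changes,
    -- as `e a 0 = 1`. Carrying `N` in the induction makes these quotients accessible, and Pascal's
    -- rule adds up the counts.
    have key : ∀ S : Finset ι, ∃ s : Finset M,
        s.card ≤ (∑ a ∈ S, if ν a = 0 then 0 else
          Nat.multinomial Finset.univ (Function.update ν a (ν a - 1))) ∧
        ∀ x : R, x • m ∈ Submodule.span K (s : Set M) ⊔
          (N ⊔ Submodule.span R {(∏ a ∈ S, e a (ν a)) • m}).restrictScalars K := by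
      intro S
      induction S using Finset.induction_on with
      | empty =>
        refine ⟨∅, by simp, fun x => ?_⟩
        simp only [Finset.coe_empty, Submodule.span_empty, bot_sup_eq, Finset.prod_empty, one_smul]
        exact Submodule.mem_sup_right
          (Submodule.smul_mem _ _ (Submodule.mem_span_singleton_self m))
      | insert a S ha ihS =>
        obtain ⟨s, hs, hspan⟩ := ihS
        rw [Finset.sum_insert ha, Finset.prod_insert ha]
        by_cases hνa : ν a = 0
        · exact ⟨s, by simpa [hνa] using hs, by simpa [hνa, h0] using hspan⟩
        · rw [if_neg hνa]
          set m' := (∏ a ∈ S, e a (ν a)) • m with hm'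
          set N' := N ⊔ Submodule.span R {(e a (ν a) * ∏ a ∈ S, e a (ν a)) • m} with hN'
          have hsum := sum_update_pred hνa
          obtain ⟨s', hs', hspan'⟩ := ih (Function.update ν a (ν a - 1)) (by omega) N' m' (by
            intro b k hk
            have hold : ν b < k → e b k • m' ∈ N' := fun hk => by
              rw [hm', smul_comm]
              exact Submodule.mem_sup_left (N.smul_mem _ (hm b k hk))
            by_cases hb : b = a
            · subst hb
              rw [Function.update_self] at hk
              rcases (show ν b ≤ k by omega).eq_or_lt with h | h
              · subst h
                rw [hm', ← mul_smul]
                exact Submodule.mem_sup_right (Submodule.mem_span_singleton_self _)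
              · exact hold h
            · rw [Function.update_of_ne hb] at hk
              exact hold hk)
          refine ⟨s' ∪ s, (Finset.card_union_le _ _).trans (add_le_add hs' hs), fun x => ?_⟩
          obtain ⟨y, hy, z, hz, hyz⟩ := Submodule.mem_sup.1 (hspan x)
          rw [Submodule.restrictScalars_mem] at hz
          obtain ⟨z₁, hz₁, z₂, hz₂, hz⟩ := Submodule.mem_sup.1 hz
          obtain ⟨c, rfl⟩ := Submodule.mem_span_singleton.1 hz₂
          rw [← hyz, ← hz, Finset.coe_union, Submodule.span_union]
          refine add_mem ?_ (add_mem ?_ ?_)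
          · exact Submodule.mem_sup_left (Submodule.mem_sup_right hy)
          · exact Submodule.mem_sup_right (Submodule.mem_sup_left hz₁)
          · exact (sup_le_sup_right le_sup_left _ :
              Submodule.span K (s' : Set M) ⊔ N'.restrictScalars K ≤ _) (hspan' c)
    obtain ⟨s, hs, hspan⟩ := key Finset.univ
    have hne : ∑ a, ν a ≠ 0 := by omega
    refine ⟨s, by rwa [multinomial_eq_sum_update ν hne], fun x => ?_⟩
    -- The last step of the filtration, `S = univ`, already lies in `N`.
    have hmem := prod_smul_mem_of_prod_eq_one hprod hne hm
    have hN : N ⊔ Submodule.span R {(∏ a, e a (ν a)) • m} = N := by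
      rw [sup_eq_left, Submodule.span_singleton_le_iff_mem]
      exact hmem
    rw [← hN]
    exact hspan x

end CyclicBound

/-! ### Newton's identities and the action of elementary symmetric functions. -/

section Newton

variable {K R : Type*} [Field K] [CommRing R] [Algebra K R]

variable (K) in
/-- The elementary symmetric functions in terms of the power sums `p 1, p 2, …`. -/
noncomputable def newtonE (p : ℕ → R) : ℕ → R
  | 0 => 1
  | k + 1 => ((k + 1 : K)⁻¹) • ∑ j : Fin (k + 1), (-1) ^ (j : ℕ) * p (j + 1) * newtonE p (k - j)

variable (K)

theorem newtonE_zero (p : ℕ → R) : newtonE K p 0 = 1 := by rw [newtonE]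

variable [CharZero K]

theorem newtonE_succ (p : ℕ → R) (k : ℕ) : ((k + 1 : ℕ) : R) * newtonE K p (k + 1) =
    ∑ j ∈ Finset.range (k + 1), (-1) ^ j * p (j + 1) * newtonE K p (k - j) := by
  rw [newtonE, Finset.sum_range, ← nsmul_eq_mul, ← Nat.cast_smul_eq_nsmul K, smul_smul]
  push_cast
  rw [mul_inv_cancel₀ (Nat.cast_add_one_ne_zero k), one_smul]

/-- Newton's identities as a differential equation. -/
theorem derivative_mk_newtonE (p : ℕ → R) :
    PowerSeries.derivative R (PowerSeries.mk (newtonE K p)) =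
      PowerSeries.mk (fun j => (-1) ^ j * p (j + 1)) * PowerSeries.mk (newtonE K p) := by
  ext k
  rw [PowerSeries.coeff_derivative, PowerSeries.coeff_mul, PowerSeries.coeff_mk,
    Finset.Nat.sum_antidiagonal_eq_sum_range_succ_mk, mul_comm]
  have := newtonE_succ K p k
  push_cast at this
  rw [this]
  simp

/-- The logarithmic derivative of the product is the sum of the power sum series, which vanishes; in
characteristic zero the product is then its constant term. -/
theorem prod_mk_newtonE_eq_one {ι : Type*} [Fintype ι] [DecidableEq ι] (p : ι → ℕ → R)
    (hp : ∀ i, ∑ a, p a (i + 1) = 0) :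
    ∏ a, PowerSeries.mk (newtonE K (p a)) = 1 := by
  have : IsAddTorsionFree R := ⟨fun m hm x y hxy => by
    have hm' : (m : K) ≠ 0 := Nat.cast_ne_zero.2 hm
    simp only [← Nat.cast_smul_eq_nsmul K] at hxy
    rw [← inv_smul_smul₀ hm' x, hxy, inv_smul_smul₀ hm']⟩
  refine PowerSeries.derivative.ext ?_ ?_
  · have h : ∀ S : Finset ι, PowerSeries.derivative R (∏ a ∈ S, PowerSeries.mk (newtonE K (p a))) =
        (∑ a ∈ S, PowerSeries.mk (fun j => (-1) ^ j * p a (j + 1))) *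
          ∏ a ∈ S, PowerSeries.mk (newtonE K (p a)) := by
      intro S
      induction S using Finset.induction_on with
      | empty => simp
      | insert a S ha ih =>
        rw [Finset.prod_insert ha, Finset.sum_insert ha, Derivation.leibniz, ih,
          derivative_mk_newtonE, smul_eq_mul, smul_eq_mul]
        ring
    rw [h, Derivation.map_one_eq_zero]
    convert zero_mul _
    ext j
    simp [← Finset.mul_sum, hp]
  · simp [map_prod, newtonE_zero]

theorem adjoin_newtonE {ι : Type*} (p : ι → ℕ → R) :
    Algebra.adjoin K {x | ∃ a k, p a (k + 1) = x} ≤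
      Algebra.adjoin K {x | ∃ a k, newtonE K (p a) (k + 1) = x} := by
  refine Algebra.adjoin_le ?_
  rintro _ ⟨a, k, rfl⟩
  set S := Algebra.adjoin K {x | ∃ a k, newtonE K (p a) (k + 1) = x}
  have hE : ∀ k, newtonE K (p a) k ∈ S := by
    rintro (_ | k)
    · rw [newtonE_zero]
      exact one_mem S
    · exact Algebra.subset_adjoin ⟨a, k, rfl⟩
  induction k using Nat.strong_induction_on with
  | _ k ih =>
    have h := newtonE_succ K (p a) k
    rw [Finset.sum_range_succ, Nat.sub_self, newtonE_zero, mul_one] at h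
    have h2 : p a (k + 1) = (-1) ^ k * (((k + 1 : ℕ) : R) * newtonE K (p a) (k + 1) -
        ∑ j ∈ Finset.range k, (-1) ^ j * p a (j + 1) * newtonE K (p a) (k - j)) := by
      rw [h, add_sub_cancel_left, ← mul_assoc, ← mul_pow]
      simp
    have hneg : ∀ j : ℕ, (-1 : R) ^ j ∈ S := fun j => pow_mem (neg_mem (one_mem S)) j
    change p a (k + 1) ∈ S
    rw [h2]
    refine mul_mem (hneg k) (sub_mem (mul_mem (natCast_mem S _) (hE _)) (sum_mem fun j hj => ?_))
    exact mul_mem (mul_mem (hneg j) (ih j (Finset.mem_range.1 hj))) (hE _)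

variable {K} {V : Type*} [AddCommGroup V] [Module K V] [Module R V] [IsScalarTower K R V]

/-- If the power sums act on a chain of vectors through commuting raising operators `X i`, the
elementary symmetric functions act through the divided powers of `X 1`. -/
theorem newtonE_smul {p : ℕ → R} {X : ℕ → V →ₗ[K] V} {s : ℕ → V}
    (hpX : ∀ i j y, p (i + 1) • X (j + 1) y = X (j + 1) (p (i + 1) • y) + X (i + j + 2) y)
    (hXX : ∀ i j, Commute (X (i + 1)) (X (j + 1)))
    (hps : ∀ i k, p (i + 1) • s k = X (i + 1) (s (k + 1))) (k : ℕ) :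
    newtonE K p k • s 0 = ((k.factorial : K)⁻¹) • (X 1 ^ k) (s k) := by
  -- Commutation with `p (i + 1)` is a derivation taking `X 1` to `X (i + 2)`, which commutes with
  -- `X 1`. For `l = 0` the truncated exponent `l - 1` is harmless because of the factor `l`.
  have hpT : ∀ (i l : ℕ) (y : V), p (i + 1) • (X 1 ^ l) y =
      (X 1 ^ l) (p (i + 1) • y) + (l : K) • X (i + 2) ((X 1 ^ (l - 1)) y) := by
    intro i l
    induction l with
    | zero => simp
    | succ l ih =>
      intro y
      have hc : X 1 (X (i + 2) ((X 1 ^ (l - 1)) y)) = X (i + 2) (X 1 ((X 1 ^ (l - 1)) y)) :=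
        LinearMap.congr_fun (hXX 0 (i + 1)).eq _
      have h0 := hpX i 0 ((X 1 ^ l) y)
      rw [zero_add, add_zero] at h0
      rw [pow_succ', Module.End.mul_apply, h0, ih, map_add, map_smul (X 1) (l : K), hc,
        Module.End.mul_apply, Nat.add_sub_cancel]
      rcases l with _ | l
      · simp
      · rw [Nat.add_sub_cancel, ← Module.End.mul_apply (X 1) (X 1 ^ l), ← pow_succ', add_assoc]
        congr 1
        push_cast
        module
  induction k using Nat.strong_induction_on with
  | _ k ih =>
    rcases k with _ | k
    · simp [newtonE_zero]
    -- The two terms produced by `hpT` and `hps` are consecutive values of `G`, so Newton's sum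
    -- telescopes to `G 0`; the value `0` beyond `k` closes the telescope.
    · let G : ℕ → V := fun j => if j ≤ k then
        ((-1 : K) ^ j * ((k - j).factorial : K)⁻¹) • X (j + 1) ((X 1 ^ (k - j)) (s (k - j + 1)))
        else 0
      have hterm : ∀ j ∈ Finset.range (k + 1),
          ((-1) ^ j * p (j + 1) * newtonE K p (k - j)) • s 0 = G j - G (j + 1) := by
        intro j hj
        have hj : j ≤ k := Nat.lt_succ_iff.1 (Finset.mem_range.1 hj)
        have hcast : ((-1 : R) ^ j) = algebraMap K R ((-1) ^ j) := by simp
        rw [mul_assoc, mul_smul, mul_smul, ih (k - j) (by omega), hcast, algebraMap_smul,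
          smul_comm (p (j + 1)), hpT, hps]
        have hc : (X 1 ^ (k - j)) (X (j + 1) (s (k - j + 1))) =
            X (j + 1) ((X 1 ^ (k - j)) (s (k - j + 1))) :=
          LinearMap.congr_fun ((hXX 0 j).pow_left (k - j)).eq _
        rw [hc]
        simp only [G, if_pos hj]
        by_cases hj' : j + 1 ≤ k
        · obtain ⟨l, rfl⟩ := Nat.exists_eq_add_of_le hj'
          have h1 : j + 1 + l - j = l + 1 := by omega
          have h2 : j + 1 + l - (j + 1) = l := by omega
          rw [if_pos hj', h1, h2, Nat.add_sub_cancel, smul_add, smul_add, smul_smul, smul_smul,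
            smul_smul, sub_eq_add_neg, ← neg_smul]
          congr 2
          rw [Nat.factorial_succ]
          have h3 : (l.factorial : K) ≠ 0 := Nat.cast_ne_zero.2 (Nat.factorial_ne_zero l)
          have h4 : (l : K) + 1 ≠ 0 := Nat.cast_add_one_ne_zero l
          push_cast
          field_simp
          ring
        · have : k - j = 0 := by omega
          rw [if_neg hj', this]
          simp
      have hsum := newtonE_succ K p k
      have h2 := congrArg (fun x : R => x • s 0) hsum
      simp only [Finset.sum_smul] at h2
      rw [Finset.sum_congr rfl hterm, Finset.sum_range_sub'] at h2
      simp only [G, if_pos (Nat.zero_le k), if_neg (Nat.not_succ_le_self k), sub_zero, pow_zero,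
        one_mul, zero_add, Nat.sub_zero] at h2
      rw [← Module.End.mul_apply, ← pow_succ', mul_smul, Nat.cast_smul_eq_nsmul,
        ← Nat.cast_smul_eq_nsmul K] at h2
      have hk : ((k + 1 : ℕ) : K) ≠ 0 := Nat.cast_ne_zero.2 (Nat.succ_ne_zero k)
      rw [← inv_smul_smul₀ hk (newtonE K p (k + 1) • s 0), h2, smul_smul, Nat.factorial_succ]
      push_cast
      rw [mul_inv]

end Newton

/-! ### Families of vectors modelled on symmetrized tensors, and their diagonal orbits. -/

section GlFamily

variable {ι : Type*} {V : Type*} [AddCommGroup V] [Module ℂ V]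

variable (E : ι → ι → ℂ[X] →ₗ[ℂ] Module.End ℂ V)

/-- The algebra generated by the diagonal operators of positive degree. -/
def cartanAlgebra : Subalgebra ℂ (Module.End ℂ V) :=
  Algebra.adjoin ℂ {x | ∃ a i, E a a (Polynomial.X ^ (i + 1)) = x}

/-- The orbit of a vector under the diagonal operators of positive degree. -/
def cartanOrbit (y : V) : Submodule ℂ V :=
  (Subalgebra.toSubmodule (cartanAlgebra E)).map (LinearMap.applyₗ y)

variable {E}

theorem mem_cartanOrbit {y z : V} :
    z ∈ cartanOrbit E y ↔ ∃ x ∈ cartanAlgebra E, x y = z := Iff.rfl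

theorem self_mem_cartanOrbit (y : V) : y ∈ cartanOrbit E y :=
  ⟨1, one_mem (cartanAlgebra E), rfl⟩

variable [Fintype ι] [DecidableEq ι]

/-- Operators `E a b P` satisfying the relations of `gl_ι ⊗ ℂ[X]`, in which the identity matrix
times `P` acts by the scalar `n P(0)`, with a family of vectors `v ν` for `|ν| = n` that behaves
like the family of symmetrized tensors in the `n`-th symmetric power of `ℂ^ι ⊗ ℂ[X]`. -/
structure IsSymmetricFamily (n : ℕ) (E : ι → ι → ℂ[X] →ₗ[ℂ] Module.End ℂ V) (v : (ι → ℕ) → V) :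
    Prop where
  comm : ∀ a b c d P Q, E a b P * E c d Q = E c d Q * E a b P +
    ((if b = c then E a d (P * Q) else 0) - (if a = d then E c b (P * Q) else 0))
  central : ∀ P, ∑ a, E a a P = (n * P.eval 0 : ℂ) • (1 : Module.End ℂ V)
  swap : ∀ κ : ι → ℕ, ∑ c, κ c + 1 = n → ∀ a b P,
    E a b P (v (κ + Pi.single b 1)) = E a a P (v (κ + Pi.single a 1))
  eq_zero : ∀ ν : ι → ℕ, ∑ c, ν c = n → ∀ a b P, ν b = 0 → E a b P (v ν) = 0
  weight : ∀ ν : ι → ℕ, ∑ c, ν c = n → ∀ a, E a a 1 (v ν) = (ν a : ℂ) • v ν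

variable {n : ℕ} {v : (ι → ℕ) → V}

namespace IsSymmetricFamily

variable (h : IsSymmetricFamily n E v)
include h

theorem commute_diag (a b : ι) (P Q : ℂ[X]) : Commute (E a a P) (E b b Q) := by
  rw [commute_iff_eq]
  have := h.comm a a b b P Q
  by_cases hab : a = b
  · subst hab
    simpa using this
  · simpa [hab] using this

theorem commute_offDiag {a b : ι} (hab : b ≠ a) (P Q : ℂ[X]) : Commute (E a b P) (E a b Q) := by
  rw [commute_iff_eq]
  simpa [hab, hab.symm] using h.comm a b a b P Q

/-- Choose another index `b` and move units of `ν` from `a` to `b`. By `newtonE_smul`, `e_{a,k}`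
acts as a divided power of `E a b X` on the vector with `k` units moved, and only `ν a` units are
available. -/
theorem exists_newtonE_smul [Nontrivial ι] {R : Type*} [CommRing R] [Algebra ℂ R] [Module R V]
    [IsScalarTower ℂ R V] {p : ι → ℕ → R}
    (hp : ∀ a i y, p a (i + 1) • y = E a a (Polynomial.X ^ (i + 1)) y)
    {ν : ι → ℕ} (hν : ∑ c, ν c = n) (a : ι) (k : ℕ) (hk : ν a < k) :
    newtonE ℂ (p a) k • v ν = 0 := by
  obtain ⟨b, hb⟩ := exists_ne a
  let κ : ι → ℕ := Function.update ν a 0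
  have hκ : κ + Pi.single a (ν a) = ν := by
    ext c
    by_cases hc : c = a
    · subst hc; simp [κ]
    · simp [κ, hc]
  have hsum : ∑ c, κ c + ν a = n := by
    rw [← hν]
    conv_rhs => rw [← hκ]
    simp [Finset.sum_add_distrib]
  have hsum' : ∀ i j, ∑ c, (κ + Pi.single a i + Pi.single b j : ι → ℕ) c = ∑ c, κ c + i + j := by
    intro i j
    simp [Finset.sum_add_distrib]
  -- The chain is extended by `0` beyond `ν a`. This respects the recursion, since at `j = ν a` the
  -- multiplicity of `a` is zero and `eq_zero` applies.
  let s : ℕ → V := fun j =>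
    if j ≤ ν a then v (κ + Pi.single a (ν a - j) + Pi.single b j) else 0
  have hs0 : s 0 = v ν := by simp [s, hκ]
  have key := newtonE_smul (K := ℂ) (p := p a) (X := fun i => E a b (Polynomial.X ^ i)) (s := s)
    (fun i j y => ?_) (fun i j => h.commute_offDiag hb _ _) (fun i k => ?_) k
  · rw [hs0] at key
    rw [key]
    simp [s, hk.not_ge]
  · have := LinearMap.congr_fun (h.comm a a a b (Polynomial.X ^ (i + 1)) (Polynomial.X ^ (j + 1))) y
    simp only [if_true, if_neg hb.symm, sub_zero, ← pow_add, Module.End.mul_apply,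
      LinearMap.add_apply] at this
    rw [hp, hp, this, show i + 1 + (j + 1) = i + j + 2 by ring]
  · rw [hp]
    simp only [s]
    rcases lt_trichotomy k (ν a) with hlt | rfl | hgt
    · rw [if_pos hlt.le, if_pos (show k + 1 ≤ ν a by omega)]
      have hsw := h.swap (κ + Pi.single a (ν a - (k + 1)) + Pi.single b k)
        (by rw [hsum']; omega) a b (Polynomial.X ^ (i + 1))
      have h1 : (Pi.single b (k + 1) : ι → ℕ) = Pi.single b k + Pi.single b 1 := by
        rw [← Pi.single_add]
      have h2 : (Pi.single a (ν a - k) : ι → ℕ) =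
          Pi.single a (ν a - (k + 1)) + Pi.single a 1 := by
        rw [← Pi.single_add, show ν a - (k + 1) + 1 = ν a - k by omega]
      rw [h1, h2, ← add_assoc, ← add_assoc, hsw, add_right_comm]
    · rw [if_pos le_rfl, if_neg (by omega), map_zero, Nat.sub_self]
      refine h.eq_zero _ (by rw [hsum']; omega) a a _ ?_
      simp [κ, hb.symm]
    · rw [if_neg (by omega), if_neg (by omega), map_zero, map_zero]

open scoped IsMulCommutative in
theorem exists_finset_cartanOrbit_le [Nontrivial ι] {ν : ι → ℕ} (hν : ∑ c, ν c = n) :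
    ∃ s : Finset V, s.card ≤ Nat.multinomial Finset.univ ν ∧
      cartanOrbit E (v ν) ≤ Submodule.span ℂ (s : Set V) := by
  have hcomm : ∀ x ∈ {x | ∃ a i, E a a (Polynomial.X ^ (i + 1)) = x},
      ∀ y ∈ {x | ∃ a i, E a a (Polynomial.X ^ (i + 1)) = x}, x * y = y * x := by
    rintro _ ⟨a, i, rfl⟩ _ ⟨b, j, rfl⟩
    exact h.commute_diag a b _ _
  have := Algebra.isMulCommutative_adjoin ℂ hcomm
  let R := Algebra.adjoin ℂ {x | ∃ a i, E a a (Polynomial.X ^ (i + 1)) = x}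
  -- The exponent is written so that every value is a generator of `R`. Newton's formulas never use
  -- the value at index `0`.
  let p : ι → ℕ → R := fun a i => ⟨E a a (Polynomial.X ^ (i - 1 + 1)),
    Algebra.subset_adjoin ⟨a, i - 1, rfl⟩⟩
  have hp : ∀ a i (y : V), p a (i + 1) • y = E a a (Polynomial.X ^ (i + 1)) y :=
    fun a i y => rfl
  have hp0 : ∀ i, ∑ a, p a (i + 1) = 0 := by
    intro i
    apply Subtype.ext
    have := h.central (Polynomial.X ^ (i + 1))
    rw [AddSubmonoidClass.coe_finsetSum]
    simpa [p] using this
  have hgen : Algebra.adjoin ℂ {x | ∃ a k, newtonE ℂ (p a) (k + 1) = x} = ⊤ := by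
    rw [eq_top_iff]
    refine le_trans (le_trans (Algebra.adjoin_adjoin_coe_preimage (R := ℂ)
      (s := {x | ∃ a i, E a a (Polynomial.X ^ (i + 1)) = x})).ge (Algebra.adjoin_mono ?_))
      (adjoin_newtonE ℂ p)
    rintro ⟨_, _⟩ ⟨a, i, rfl⟩
    exact ⟨a, i, rfl⟩
  obtain ⟨s, hs, hspan⟩ := exists_finset_span_of_prod_eq_one (K := ℂ) (M := V)
    (fun a => newtonE_zero ℂ (p a)) (prod_mk_newtonE_eq_one ℂ p hp0) hgen n ν hν ⊥ (v ν)
    fun a k hk => by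
      rw [Submodule.mem_bot]
      exact h.exists_newtonE_smul hp hν a k hk
  refine ⟨s, hs, ?_⟩
  rintro _ ⟨x, hx, rfl⟩
  have hx' := hspan ⟨x, hx⟩
  rw [Submodule.restrictScalars_bot, sup_bot_eq] at hx'
  exact hx'

theorem finiteDimensional_cartanOrbit [Nontrivial ι] {ν : ι → ℕ} (hν : ∑ c, ν c = n) :
    FiniteDimensional ℂ (cartanOrbit E (v ν)) := by
  obtain ⟨s, -, hs⟩ := h.exists_finset_cartanOrbit_le hν
  exact Submodule.finiteDimensional_of_le hs

theorem finrank_cartanOrbit_le [Nontrivial ι] {ν : ι → ℕ} (hν : ∑ c, ν c = n) :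
    Module.finrank ℂ (cartanOrbit E (v ν)) ≤ Nat.multinomial Finset.univ ν := by
  obtain ⟨s, hcard, hs⟩ := h.exists_finset_cartanOrbit_le hν
  exact (Submodule.finrank_mono hs).trans ((finrank_span_finset_le_card s).trans hcard)

theorem diag_one_apply {ν : ι → ℕ} (hν : ∑ c, ν c = n) (a : ι) {y : V}
    (hy : y ∈ cartanOrbit E (v ν)) : E a a 1 y = (ν a : ℂ) • y := by
  obtain ⟨x, hx, rfl⟩ := mem_cartanOrbit.1 hy
  have hc : Commute (E a a 1) x := by
    refine Algebra.commute_of_mem_adjoin_of_forall_mem_commute (R := ℂ) hx ?_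
    rintro _ ⟨b, i, rfl⟩
    exact h.commute_diag a b _ _
  have h2 := LinearMap.congr_fun hc.eq (v ν)
  rw [Module.End.mul_apply, Module.End.mul_apply, h.weight ν hν, map_smul] at h2
  exact h2

theorem diag_mem_cartanOrbit {ν : ι → ℕ} (hν : ∑ c, ν c = n) (a : ι) (P : ℂ[X]) :
    E a a P (v ν) ∈ cartanOrbit E (v ν) := by
  induction P using Polynomial.induction_on' with
  | add P Q hP hQ =>
    rw [map_add, LinearMap.add_apply]
    exact add_mem hP hQ
  | monomial i c =>
    rw [← Polynomial.smul_X_eq_monomial, map_smul, LinearMap.smul_apply]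
    refine Submodule.smul_mem _ _ ?_
    rcases i with _ | i
    · rw [pow_zero, h.weight ν hν]
      exact Submodule.smul_mem _ _ (self_mem_cartanOrbit _)
    · exact ⟨_, Algebra.subset_adjoin ⟨a, i, rfl⟩, rfl⟩

/-- The sum of the orbits of the vectors of the family is stable under all operators. -/
theorem mem_iSup_cartanOrbit (a b : ι) (P : ℂ[X]) {y : V}
    (hy : y ∈ ⨆ ν ∈ Finset.piAntidiag Finset.univ n, cartanOrbit E (v ν)) :
    E a b P y ∈ ⨆ ν ∈ Finset.piAntidiag Finset.univ n, cartanOrbit E (v ν) := by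
  set Z := ⨆ ν ∈ Finset.piAntidiag (Finset.univ : Finset ι) n, cartanOrbit E (v ν) with hZ
  have hle : ∀ ν : ι → ℕ, ∑ c, ν c = n → cartanOrbit E (v ν) ≤ Z := fun ν hν =>
    le_iSup₂_of_le ν (by simpa using hν) le_rfl
  have hZstable : ∀ x ∈ cartanAlgebra E, Z ≤ Z.comap x := by
    intro x hx
    refine iSup₂_le fun ν hν => ?_
    rintro _ ⟨x', hx', rfl⟩
    exact hle ν (by simpa using hν) ⟨x * x', (cartanAlgebra E).mul_mem hx hx', rfl⟩
  -- Moving `E a b P` past a diagonal generator creates only further operators of the same kind, so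
  -- it is enough to test all of them on the vectors `v ν`.
  have hx : ∀ x ∈ cartanAlgebra E, ∀ y, (∀ a b P, E a b P y ∈ Z) → ∀ a b P, E a b P (x y) ∈ Z := by
    intro x hx
    induction hx using Algebra.adjoin_induction with
    | mem x hx =>
      intro y hy a b P
      obtain ⟨c, i, rfl⟩ := hx
      rw [← Module.End.mul_apply, h.comm, LinearMap.add_apply, LinearMap.sub_apply,
        Module.End.mul_apply]
      refine add_mem (hZstable _ (Algebra.subset_adjoin ⟨c, i, rfl⟩) (hy _ _ _)) (sub_mem ?_ ?_)
      · split_ifs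
        exacts [hy _ _ _, zero_mem _]
      · split_ifs
        exacts [hy _ _ _, zero_mem _]
    | algebraMap c =>
      intro y hy a b P
      rw [Module.algebraMap_end_apply, map_smul]
      exact Submodule.smul_mem _ _ (hy a b P)
    | add x x' _ _ hx hx' =>
      intro y hy a b P
      rw [LinearMap.add_apply, map_add]
      exact add_mem (hx y hy a b P) (hx' y hy a b P)
    | mul x x' _ _ hx hx' =>
      intro y hy a b P
      exact hx _ (hx' y hy) a b P
  revert y
  change Z ≤ Z.comap (E a b P)
  refine iSup₂_le fun ν hν => ?_
  have hν : ∑ c, ν c = n := by simpa using hν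
  rintro _ ⟨x, hx', rfl⟩
  refine hx x hx' (v ν) (fun a b P => ?_) a b P
  by_cases hb : ν b = 0
  · rw [h.eq_zero ν hν a b P hb]
    exact zero_mem _
  -- With one unit of `b` split off, `swap` turns the off-diagonal operator into a diagonal one on a
  -- neighbouring vector of the family.
  · have hκ : Function.update ν b (ν b - 1) + Pi.single b 1 = ν := by
      ext c
      by_cases hc : c = b
      · subst hc
        simp only [Pi.add_apply, Function.update_self, Pi.single_eq_same]
        omega
      · simp [hc]
    have hs := sum_update_pred hb
    rw [← hκ, h.swap _ (by omega)]
    have hsum : ∑ c, (Function.update ν b (ν b - 1) + Pi.single a 1 : ι → ℕ) c = n := by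
      simp only [Pi.add_apply, Finset.sum_add_distrib, Finset.sum_pi_single', Finset.mem_univ,
        if_true]
      omega
    exact hle _ hsum (h.diag_mem_cartanOrbit hsum a P)

end IsSymmetricFamily

theorem sum_multinomial_piAntidiag (n : ℕ) :
    ∑ ν ∈ Finset.piAntidiag (Finset.univ : Finset ι) n, Nat.multinomial Finset.univ ν =
      Fintype.card ι ^ n := by
  have := Finset.sum_pow_eq_sum_piAntidiag (Finset.univ : Finset ι) (fun _ => (1 : ℕ)) n
  simpa using this.symm

theorem IsSymmetricFamily.finiteDimensional [Nontrivial ι] (h : IsSymmetricFamily n E v)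
    (htop : ⨆ ν ∈ Finset.piAntidiag Finset.univ n, cartanOrbit E (v ν) = ⊤) :
    FiniteDimensional ℂ V := by
  have : ∀ ν : Finset.piAntidiag (Finset.univ : Finset ι) n,
      FiniteDimensional ℂ (cartanOrbit E (v ν)) := fun ν =>
    h.finiteDimensional_cartanOrbit (Finset.mem_piAntidiag.1 ν.2).1
  rw [iSup_subtype'] at htop
  have h2 : FiniteDimensional ℂ (⊤ : Submodule ℂ V) := htop ▸ inferInstance
  exact Module.finite_def.2 ((Submodule.fg_top _).1 (Module.finite_def.1 h2))

theorem finrank_iSup_le_sum {K ι V : Type*} [Field K] [AddCommGroup V] [Module K V]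
    [FiniteDimensional K V] (S : Finset ι) (p : ι → Submodule K V) :
    Module.finrank K (⨆ i ∈ S, p i : Submodule K V) ≤ ∑ i ∈ S, Module.finrank K (p i) := by
  classical
  induction S using Finset.induction_on with
  | empty => simp
  | insert i S hi ih =>
    rw [Finset.iSup_insert, Finset.sum_insert hi]
    exact (Submodule.finrank_add_le_finrank_add_finrank _ _).trans (Nat.add_le_add_left ih _)

theorem IsSymmetricFamily.finrank_le [Nontrivial ι] (h : IsSymmetricFamily n E v)
    (htop : ⨆ ν ∈ Finset.piAntidiag Finset.univ n, cartanOrbit E (v ν) = ⊤) :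
    Module.finrank ℂ V ≤ Fintype.card ι ^ n := by
  have hf : FiniteDimensional ℂ V := h.finiteDimensional htop
  rw [← sum_multinomial_piAntidiag, ← finrank_top, ← htop]
  exact (finrank_iSup_le_sum _ _).trans (Finset.sum_le_sum fun ν hν =>
    h.finrank_cartanOrbit_le (Finset.mem_piAntidiag.1 hν).1)

/-- If the module has the largest possible dimension, then so does every orbit. -/
theorem IsSymmetricFamily.finrank_cartanOrbit_eq [Nontrivial ι] (h : IsSymmetricFamily n E v)
    (htop : ⨆ ν ∈ Finset.piAntidiag Finset.univ n, cartanOrbit E (v ν) = ⊤)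
    (hdim : Module.finrank ℂ V = Fintype.card ι ^ n) {ν : ι → ℕ} (hν : ∑ c, ν c = n) :
    Module.finrank ℂ (cartanOrbit E (v ν)) = Nat.multinomial Finset.univ ν := by
  have hf : FiniteDimensional ℂ V := h.finiteDimensional htop
  have hle := fun ν hν => h.finrank_cartanOrbit_le (Finset.mem_piAntidiag.1 hν : _ ∧ _).1 (ν := ν)
  refine (Finset.sum_eq_sum_iff_of_le hle).1 (le_antisymm (Finset.sum_le_sum hle) ?_) ν
    (by simpa using hν)
  rw [sum_multinomial_piAntidiag, ← hdim, ← finrank_top, ← htop]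
  exact finrank_iSup_le_sum _ _

end GlFamily

/-! ### Extension of the action from `sl_{r+1} ⊗ ℂ[X]` to `gl_{r+1} ⊗ ℂ[X]`. -/

section GlAction

attribute [local instance 100] LieRing.ofAssociativeRing

/-- The projection of `gl_{r+1}` to `sl_{r+1}` along the scalar matrices. -/
noncomputable def tracelessPart (r : ℕ) :
    Matrix (Fin (r + 1)) (Fin (r + 1)) ℂ →ₗ[ℂ] sl (Fin (r + 1)) ℂ :=
  LinearMap.codRestrict _ (LinearMap.id -
    (Matrix.traceLinearMap (Fin (r + 1)) ℂ ℂ).smulRight ((r + 1 : ℂ)⁻¹ • 1)) fun y => by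
      have h : (r + 1 : ℂ) ≠ 0 := Nat.cast_add_one_ne_zero r
      refine LinearMap.mem_ker.2 ?_
      simp [Matrix.trace_sub, Matrix.trace_smul, h]

theorem val_tracelessPart {r : ℕ} (y : Matrix (Fin (r + 1)) (Fin (r + 1)) ℂ) :
    (tracelessPart r y).val = y - y.trace • (r + 1 : ℂ)⁻¹ • 1 := rfl

theorem tracelessPart_of_trace_eq_zero {r : ℕ} (y : sl (Fin (r + 1)) ℂ) :
    tracelessPart r y.val = y := by
  have h : y.val.trace = 0 := y.2
  apply Subtype.ext
  rw [val_tracelessPart, h, zero_smul, sub_zero]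

theorem tracelessPart_commutator {r : ℕ} (y z : Matrix (Fin (r + 1)) (Fin (r + 1)) ℂ) :
    tracelessPart r (y * z - z * y) = ⁅tracelessPart r y, tracelessPart r z⁆ := by
  apply Subtype.ext
  rw [sl_bracket, val_tracelessPart, val_tracelessPart, val_tracelessPart, Matrix.trace_sub,
    Matrix.trace_mul_comm, sub_self, zero_smul, sub_zero, smul_smul, smul_smul]
  simp only [sub_mul, mul_sub, smul_mul_assoc, mul_smul_comm, one_mul, mul_one]
  module

variable {r : ℕ} (n : ℕ) (V : Type*) [AddCommGroup V] [Module ℂ V]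
  [LieRingModule (Current r ℂ[X]) V] [LieModule ℂ (Current r ℂ[X]) V]

/-- The action of `gl_{r+1} ⊗ ℂ[X]` on an `sl_{r+1} ⊗ ℂ[X]`-module in which the identity matrix
times `P` acts by the scalar `n P(0)`. -/
noncomputable def glAction :
    Matrix (Fin (r + 1)) (Fin (r + 1)) ℂ →ₗ[ℂ] ℂ[X] →ₗ[ℂ] Module.End ℂ V :=
  LinearMap.mk₂ ℂ (fun y P => LieModule.toEnd ℂ (Current r ℂ[X]) V (P ⊗ₜ tracelessPart r y) +
      (n * P.eval 0 * y.trace * (r + 1 : ℂ)⁻¹) • 1)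
    (fun y z P => by
      rw [map_add, TensorProduct.tmul_add, map_add, Matrix.trace_add]
      module)
    (fun c y P => by
      rw [map_smul, TensorProduct.tmul_smul, map_smul, Matrix.trace_smul, smul_eq_mul]
      module)
    (fun y P Q => by
      rw [TensorProduct.add_tmul, map_add, Polynomial.eval_add]
      module)
    (fun c y P => by
      rw [← TensorProduct.smul_tmul', map_smul, Polynomial.eval_smul, smul_eq_mul]
      module)

theorem glAction_apply (y : Matrix (Fin (r + 1)) (Fin (r + 1)) ℂ) (P : ℂ[X]) :
    glAction n V y P = LieModule.toEnd ℂ (Current r ℂ[X]) V (P ⊗ₜ tracelessPart r y) +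
      (n * P.eval 0 * y.trace * (r + 1 : ℂ)⁻¹) • 1 := rfl

theorem glAction_sl (y : sl (Fin (r + 1)) ℂ) (P : ℂ[X]) (m : V) :
    glAction n V y.val P m = ⁅(P ⊗ₜ[ℂ] y : Current r ℂ[X]), m⁆ := by
  have h : y.val.trace = 0 := y.2
  rw [glAction_apply, tracelessPart_of_trace_eq_zero, h, mul_zero, zero_mul, zero_smul, add_zero]
  rfl

theorem glAction_one (P : ℂ[X]) :
    glAction n V (1 : Matrix (Fin (r + 1)) (Fin (r + 1)) ℂ) P = (n * P.eval 0 : ℂ) • 1 := by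
  have h : (r + 1 : ℂ) ≠ 0 := Nat.cast_add_one_ne_zero r
  have h0 : tracelessPart r 1 = 0 := by
    apply Subtype.ext
    rw [val_tracelessPart, Matrix.trace_one, Fintype.card_fin, smul_smul]
    push_cast
    rw [mul_inv_cancel₀ h, one_smul, sub_self]
  rw [glAction_apply, h0, TensorProduct.tmul_zero, map_zero, zero_add, Matrix.trace_one,
    Fintype.card_fin]
  push_cast
  rw [mul_assoc, mul_inv_cancel₀ h, mul_one]

theorem glAction_mul (y z : Matrix (Fin (r + 1)) (Fin (r + 1)) ℂ) (P Q : ℂ[X]) :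
    glAction n V y P * glAction n V z Q =
      glAction n V z Q * glAction n V y P + glAction n V (y * z - z * y) (P * Q) := by
  rw [glAction_apply n V (y * z - z * y), tracelessPart_commutator,
    ← LieAlgebra.ExtendScalars.bracket_tmul, LieHom.map_lie, Matrix.trace_sub,
    Matrix.trace_mul_comm, sub_self, mul_zero, zero_mul, zero_smul, add_zero,
    LieRing.of_associative_ring_bracket, glAction_apply, glAction_apply]
  simp only [add_mul, mul_add, smul_mul_assoc, mul_smul_comm, one_mul, mul_one]
  module

/-- The operators of the matrix units. -/
noncomputable def unitAction (a b : Fin (r + 1)) : ℂ[X] →ₗ[ℂ] Module.End ℂ V :=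
  glAction n V (Matrix.single a b 1)

theorem unitAction_mul (a b c d : Fin (r + 1)) (P Q : ℂ[X]) :
    unitAction n V a b P * unitAction n V c d Q = unitAction n V c d Q * unitAction n V a b P +
      ((if b = c then unitAction n V a d (P * Q) else 0) -
        (if a = d then unitAction n V c b (P * Q) else 0)) := by
  rw [unitAction, unitAction, glAction_mul, map_sub, LinearMap.sub_apply]
  congr 2
  · split_ifs with h
    · subst h; simp [unitAction]
    · simp [Matrix.single_mul_single_of_ne _ _ _ _ h]
  · split_ifs with h
    · subst h; simp [unitAction]
    · simp [Matrix.single_mul_single_of_ne _ _ _ _ (Ne.symm h)]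

theorem sum_unitAction (P : ℂ[X]) :
    ∑ a : Fin (r + 1), unitAction n V a a P = (n * P.eval 0 : ℂ) • 1 := by
  rw [← glAction_one (r := r), ← LinearMap.sum_apply]
  congr 1
  simp only [unitAction]
  rw [← map_sum, ← Matrix.sum_single_one]

theorem unitAction_posRoot (a b : Fin (r + 1)) (h : a < b) (P : ℂ[X]) (m : V) :
    unitAction n V a b P m = ⁅(P ⊗ₜ[ℂ] posRoot a b h : Current r ℂ[X]), m⁆ := by
  rw [← glAction_sl n]
  rfl

theorem unitAction_coroot (i : Fin r) (P : ℂ[X]) (m : V) :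
    unitAction n V i.castSucc i.castSucc P m - unitAction n V i.succ i.succ P m =
      ⁅(P ⊗ₜ[ℂ] coroot i : Current r ℂ[X]), m⁆ := by
  rw [← glAction_sl n, coroot, val_singleSubSingle, map_sub]
  rfl

variable {V}

/-- A subspace stable under the operators of the matrix units is a submodule. -/
theorem lie_mem_of_unitAction_mem (Z : Submodule ℂ V)
    (hZ : ∀ a b P, ∀ y ∈ Z, unitAction (r := r) n V a b P y ∈ Z) (x : Current r ℂ[X]) {y : V}
    (hy : y ∈ Z) : ⁅x, y⁆ ∈ Z := by
  induction x using TensorProduct.induction_on with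
  | zero => rw [zero_lie]; exact zero_mem Z
  | add x x' hx hx' => rw [add_lie]; exact add_mem hx hx'
  | tmul P x =>
    rw [← glAction_sl n, Matrix.matrix_eq_sum_single x.val]
    simp only [map_sum, LinearMap.sum_apply]
    refine sum_mem fun a _ => sum_mem fun b _ => ?_
    have : Matrix.single a b (x.val a b) = x.val a b • Matrix.single a b (1 : ℂ) := by simp
    rw [this, map_smul, LinearMap.smul_apply, LinearMap.smul_apply]
    exact Z.smul_mem _ (hZ a b P y hy)

theorem eq_top_of_unitAction_mem {v : V}
    (hv : LieSubmodule.lieSpan ℂ (Current r ℂ[X]) {v} = ⊤) (Z : Submodule ℂ V)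
    (hZ : ∀ a b P, ∀ y ∈ Z, unitAction (r := r) n V a b P y ∈ Z) (hvZ : v ∈ Z) : Z = ⊤ := by
  let Z' : LieSubmodule ℂ (Current r ℂ[X]) V :=
    { Z with lie_mem := fun {x m} hm => lie_mem_of_unitAction_mem n Z hZ x hm }
  have h : LieSubmodule.lieSpan ℂ (Current r ℂ[X]) {v} ≤ Z' :=
    LieSubmodule.lieSpan_le.2 (Set.singleton_subset_iff.2 hvZ)
  rw [hv] at h
  exact eq_top_iff.2 fun y _ => h (LieSubmodule.mem_top y)

end GlAction

/-! ### Weight spaces, integrability and `sl_2` arguments. -/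

section Weights

variable {r : ℕ} {V : Type*} [AddCommGroup V] [Module ℂ V]
  [LieRingModule (Current r ℂ[X]) V] [LieModule ℂ (Current r ℂ[X]) V]

theorem mem_weightSpace {μ : Fin r → ℤ} {y : V} : y ∈ weightSpace r ℂ[X] V μ ↔
    ∀ i, ⁅((1 : ℂ[X]) ⊗ₜ[ℂ] coroot i : Current r ℂ[X]), y⁆ = (μ i : ℂ) • y := Iff.rfl

/-- The weight of the matrix unit `e_{ab}`. -/
def unitWeight (a b : Fin (r + 1)) (i : Fin r) : ℤ :=
  (if a = i.castSucc then 1 else 0) - (if a = i.succ then 1 else 0) -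
    (if b = i.castSucc then 1 else 0) + (if b = i.succ then 1 else 0)

theorem unitAction_mem_weightSpace (n : ℕ) (a b : Fin (r + 1)) (P : ℂ[X]) {μ : Fin r → ℤ} {y : V}
    (hy : y ∈ weightSpace r ℂ[X] V μ) :
    unitAction n V a b P y ∈ weightSpace r ℂ[X] V (μ + unitWeight a b) := by
  intro i
  have h1 := LinearMap.congr_fun
    (unitAction_mul n V i.castSucc i.castSucc a b (1 : ℂ[X]) P) y
  have h2 := LinearMap.congr_fun
    (unitAction_mul n V i.succ i.succ a b (1 : ℂ[X]) P) y
  have h3 := hy i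
  rw [← unitAction_coroot n] at h3
  rw [← unitAction_coroot n]
  simp only [Module.End.mul_apply, LinearMap.add_apply, LinearMap.sub_apply, one_mul] at h1 h2
  rw [h1, h2, add_sub_add_comm, ← map_sub, h3, map_smul]
  have e1 : ∀ (p : Prop) [Decidable p] (c d : Fin (r + 1)) (z : V), (p → c = a ∧ d = b) →
      (if p then unitAction n V c d P else 0) y =
        ((if p then 1 else 0 : ℤ) : ℂ) • unitAction n V a b P y := by
    intro p _ c d z h
    split_ifs with hp
    · obtain ⟨rfl, rfl⟩ := h hp; simp
    · simp
  rw [e1 _ _ _ y fun h => ⟨h, rfl⟩, e1 _ _ _ y fun h => ⟨rfl, h⟩, e1 _ _ _ y fun h => ⟨h, rfl⟩,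
    e1 _ _ _ y fun h => ⟨rfl, h⟩]
  simp only [Pi.add_apply, unitWeight, eq_comm (a := a), eq_comm (a := b)]
  push_cast
  module

theorem iSupIndep_weightSpace : iSupIndep fun μ : Fin r → ℤ => weightSpace r ℂ[X] V μ := by
  let f : Fin r → Module.End ℂ V := fun i =>
    LieModule.toEnd ℂ (Current r ℂ[X]) V ((1 : ℂ[X]) ⊗ₜ coroot i)
  have hf : ∀ i j, Commute (f i) (f j) := by
    intro i j
    -- The scalar added for `gl_{r+1}` cancels in the difference, so any `n` would serve; `0` is
    -- chosen.
    have h : ∀ i, f i = unitAction 0 V i.castSucc i.castSucc 1 - unitAction 0 V i.succ i.succ 1 :=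
      fun i => LinearMap.ext fun y => (unitAction_coroot 0 V i 1 y).symm
    have hd : ∀ a b : Fin (r + 1), Commute (unitAction (r := r) 0 V a a 1) (unitAction (r := r) 0 V b b 1) := by
      intro a b
      have := unitAction_mul (r := r) 0 V a a b b 1 1
      rw [commute_iff_eq]
      by_cases hab : a = b
      · subst hab; rfl
      · simpa [hab] using this
    rw [h, h]
    exact ((hd _ _).sub_right (hd _ _)).sub_left ((hd _ _).sub_right (hd _ _))
  have key := Module.End.independent_iInf_maxGenEigenspace_of_forall_mapsTo f
    fun i j φ => Module.End.mapsTo_maxGenEigenspace_of_comm (hf j i) φ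
  have hinj : Function.Injective fun (μ : Fin r → ℤ) (i : Fin r) => (μ i : ℂ) := by
    intro μ μ' h
    ext i
    exact Int.cast_injective (congrFun h i)
  refine (key.comp hinj).mono fun μ y hy => ?_
  simp only [Function.comp_apply, Submodule.mem_iInf]
  intro i
  exact Module.End.eigenspace_le_maxGenEigenspace (Module.End.mem_eigenspace_iff.2 (hy i))

/-- A module generated by a weight vector is the sum of its weight spaces. -/
theorem iSup_weightSpace_eq_top {v : V}
    (hv : LieSubmodule.lieSpan ℂ (Current r ℂ[X]) {v} = ⊤) {μ : Fin r → ℤ}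
    (hμ : v ∈ weightSpace r ℂ[X] V μ) : ⨆ μ, weightSpace r ℂ[X] V μ = ⊤ := by
  refine eq_top_of_unitAction_mem 0 hv _ (fun a b P => ?_) (le_iSup (weightSpace r ℂ[X] V) μ hμ)
  change (⨆ μ, weightSpace r ℂ[X] V μ) ≤ Submodule.comap (unitAction 0 V a b P)
    (⨆ μ, weightSpace r ℂ[X] V μ)
  refine iSup_le fun μ y hy => ?_
  exact le_iSup (weightSpace r ℂ[X] V) _ (unitAction_mem_weightSpace 0 a b P hy)

/-- The weight spaces are independent and span, and finite dimension leaves only finitely many of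
them nonzero. -/
theorem isIntegrable_of_finiteDimensional [FiniteDimensional ℂ V] {v : V}
    (hv : LieSubmodule.lieSpan ℂ (Current r ℂ[X]) {v} = ⊤) {μ : Fin r → ℤ}
    (hμ : v ∈ weightSpace r ℂ[X] V μ) : IsIntegrable r ℂ[X] V := by
  have hfin : {μ | weightSpace r ℂ[X] V μ ≠ ⊥}.Finite :=
    WellFoundedGT.finite_ne_bot_of_iSupIndep iSupIndep_weightSpace
  refine ⟨hfin.toFinset, DirectSum.isInternal_submodule_of_iSupIndep_of_iSup_eq_top
    (iSupIndep_weightSpace.comp Subtype.val_injective) ?_⟩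
  rw [eq_top_iff, ← iSup_weightSpace_eq_top hv hμ]
  refine iSup_le fun μ => ?_
  by_cases h : weightSpace r ℂ[X] V μ = ⊥
  · rw [h]; exact bot_le
  · exact le_iSup (fun μ : hfin.toFinset => weightSpace r ℂ[X] V μ.1)
      ⟨μ, hfin.mem_toFinset.2 h⟩

theorem IsIntegrable.exists_finset (h : IsIntegrable r ℂ[X] V) :
    ∃ D : Finset (Fin r → ℤ), ∀ μ ∉ D, weightSpace r ℂ[X] V μ = ⊥ := by
  obtain ⟨D, hD⟩ := h
  refine ⟨D, fun μ hμ => ?_⟩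
  have htop := hD.submodule_iSup_eq_top
  have hdis := iSupIndep_weightSpace (r := r) (V := V) μ
  refine eq_bot_iff.2 (le_trans ?_ hdis.le_bot)
  refine le_inf le_rfl (le_trans le_top ?_)
  rw [← htop]
  refine iSup_le fun μ' => le_iSup₂_of_le μ'.1 ?_ le_rfl
  rintro rfl
  exact hμ μ'.2

/-- The lowering operators are nilpotent on weight vectors of integrable modules. -/
theorem IsIntegrable.exists_pow_unitAction_eq_zero (h : IsIntegrable r ℂ[X] V) (n : ℕ)
    {a b : Fin (r + 1)} (hab : a < b) {μ : Fin r → ℤ} {y : V}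
    (hy : y ∈ weightSpace r ℂ[X] V μ) : ∃ k, (unitAction n V b a 1 ^ k) y = 0 := by
  obtain ⟨D, hD⟩ := h.exists_finset
  have hmem : ∀ k : ℕ, (unitAction n V b a 1 ^ k) y ∈
      weightSpace r ℂ[X] V (μ + k • unitWeight b a) := by
    intro k
    induction k with
    | zero => simpa using hy
    | succ k ih =>
      rw [pow_succ', Module.End.mul_apply, succ_nsmul, ← add_assoc]
      exact unitAction_mem_weightSpace n b a 1 ih
  by_contra! hne
  have hinj : Function.Injective fun k : ℕ => μ + k • unitWeight b a := by
    intro k k' hk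
    have hlt : (a : ℕ) < r := lt_of_lt_of_le hab (Nat.lt_succ_iff.1 b.2)
    have := congrFun hk ⟨a, hlt⟩
    have ha : a = Fin.castSucc ⟨a, hlt⟩ := rfl
    have ha' : a ≠ Fin.succ ⟨a, hlt⟩ := fun h => by
      have := congrArg Fin.val h
      simp at this
    -- The coroot at position `a` takes the value `-1` or `-2` on the weight of `E_{ba}`, so the
    -- weights along the string are pairwise distinct.
    have hneg : unitWeight b a ⟨a, hlt⟩ < 0 := by
      unfold unitWeight
      rw [← ha, if_neg hab.ne', if_pos rfl, if_neg ha']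
      split_ifs <;> omega
    simp only [Pi.add_apply, Pi.smul_apply, add_right_inj] at this
    rw [nsmul_eq_mul, nsmul_eq_mul] at this
    exact_mod_cast mul_right_cancel₀ hneg.ne this
  refine Set.infinite_range_of_injective hinj (D.finite_toSet.subset ?_)
  rintro _ ⟨k, rfl⟩
  by_contra hk
  have := hmem k
  rw [hD _ hk, Submodule.mem_bot] at this
  exact hne k this

/-- In the `sl_2` of `a` and `b`, `e f^{k+1} y = (k+1)(N-k) f^k y`. Hence `f^{k+1} y = 0` implies
`f^k y = 0` unless `k = N`, and the known exponent descends to `N + 1`. -/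
theorem pow_unitAction_eq_zero (n : ℕ) {a b : Fin (r + 1)} (hab : a ≠ b) {y : V} {N k : ℕ}
    (hk : (unitAction n V b a 1 ^ k) y = 0) (he : unitAction n V a b 1 y = 0)
    (hh : unitAction n V a a 1 y - unitAction n V b b 1 y = (N : ℂ) • y) :
    (unitAction n V b a 1 ^ (N + 1)) y = 0 := by
  set f := unitAction n V b a 1
  set e := unitAction n V a b 1
  set h := unitAction n V a a 1 - unitAction n V b b 1 with hdef
  have hef : e * f = f * e + h := by simpa using unitAction_mul n V a b b a 1 1
  have hhf : h * f = f * h - (2 : ℂ) • f := by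
    have h1 := unitAction_mul n V a a b a 1 1
    have h2 := unitAction_mul n V b b b a 1 1
    simp only [hab, hab.symm, if_true, if_false, mul_one, zero_sub, sub_zero] at h1 h2
    rw [hdef, sub_mul, mul_sub, h1, h2, two_smul]
    abel
  have hhk : ∀ k : ℕ, h ((f ^ k) y) = (N - 2 * k : ℂ) • (f ^ k) y := by
    intro k
    induction k with
    | zero =>
      rw [hdef, LinearMap.sub_apply, pow_zero, Module.End.one_apply, hh]
      simp
    | succ k ih =>
      rw [pow_succ', Module.End.mul_apply, ← Module.End.mul_apply h, hhf, LinearMap.sub_apply,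
        Module.End.mul_apply, ih, map_smul, LinearMap.smul_apply]
      push_cast
      module
  have hek : ∀ k : ℕ, e ((f ^ (k + 1)) y) = ((k + 1) * (N - k) : ℂ) • (f ^ k) y := by
    intro k
    induction k with
    | zero =>
      rw [pow_succ', Module.End.mul_apply, ← Module.End.mul_apply e, hef, LinearMap.add_apply,
        Module.End.mul_apply, hhk]
      simp [he]
    | succ k ih =>
      rw [pow_succ', Module.End.mul_apply, ← Module.End.mul_apply e, hef, LinearMap.add_apply,
        Module.End.mul_apply, hhk, ih, map_smul, ← Module.End.mul_apply f, ← pow_succ']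
      push_cast
      module
  induction k with
  | zero =>
    have : y = 0 := hk
    rw [this, map_zero]
  | succ k ih =>
    by_cases hkN : k = N
    · rw [← hkN]; exact hk
    · refine ih ?_
      have := hek k
      rw [hk, map_zero] at this
      refine (smul_eq_zero.1 this.symm).resolve_left (mul_ne_zero (Nat.cast_add_one_ne_zero k) ?_)
      rw [sub_ne_zero]
      exact_mod_cast Ne.symm hkN

end Weights

/-! ### The family of divided powers and the upper bound for highest weight modules. -/

section HighestWeight

variable {r n : ℕ} {V : Type*} [AddCommGroup V] [Module ℂ V]
  [LieRingModule (Current r ℂ[X]) V] [LieModule ℂ (Current r ℂ[X]) V]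

theorem sum_map_origin (i : Fin r) (P : ℂ[X]) :
    ((origin r n i).map fun z => z P).sum = if (i : ℕ) = 0 then n * P.eval 0 else 0 := by
  unfold origin
  split_ifs with h
  · simp [Polynomial.coe_aeval_eq_eval]
  · simp

/-- The weight `n ω_1`. -/
def topWeight (r n : ℕ) (i : Fin r) : ℤ := if (i : ℕ) = 0 then n else 0

variable {v : V}

theorem mem_weightSpace_topWeight
    (hc : ∀ (i : Fin r) (P : ℂ[X]), ⁅(P ⊗ₜ[ℂ] coroot i : Current r ℂ[X]), v⁆ =
      ((origin r n i).map fun z => z P).sum • v) :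
    v ∈ weightSpace r ℂ[X] V (topWeight r n) := by
  intro i
  rw [hc, sum_map_origin, topWeight]
  simp

/-- The coroots prescribe the differences of consecutive diagonal operators on `v`, and the identity
matrix prescribes their sum. -/
theorem unitAction_diag_apply
    (hc : ∀ (i : Fin r) (P : ℂ[X]), ⁅(P ⊗ₜ[ℂ] coroot i : Current r ℂ[X]), v⁆ =
      ((origin r n i).map fun z => z P).sum • v) (a : Fin (r + 1)) (P : ℂ[X]) :
    unitAction n V a a P v = (if a = 0 then n * P.eval 0 else 0 : ℂ) • v := by
  have h : ∀ a : Fin (r + 1), unitAction n V a a P v =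
      unitAction (r := r) n V 0 0 P v - (if a = 0 then 0 else n * P.eval 0 : ℂ) • v := by
    intro a
    induction a using Fin.induction with
    | zero => simp
    | succ i ih =>
      have h := unitAction_coroot n V i P v
      rw [hc, sum_map_origin] at h
      rw [← sub_sub_cancel (unitAction n V i.castSucc i.castSucc P v)
        (unitAction n V i.succ i.succ P v), h, ih, if_neg (Fin.succ_ne_zero i)]
      by_cases hi : (i : ℕ) = 0
      · have : i.castSucc = 0 := Fin.ext hi
        simp [hi, this]
      · have : i.castSucc ≠ 0 := fun h => hi (congrArg Fin.val h)
        simp [hi, this]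
  have hsum := LinearMap.congr_fun (sum_unitAction (r := r) n V P) v
  rw [LinearMap.sum_apply, Fin.sum_univ_succ, Finset.sum_congr rfl fun j _ => h (Fin.succ j)] at hsum
  simp only [Fin.succ_ne_zero, if_false, Finset.sum_const, Finset.card_univ, Fintype.card_fin,
    LinearMap.smul_apply, Module.End.one_apply] at hsum
  have h0 : unitAction (r := r) n V 0 0 P v = (n * P.eval 0 : ℂ) • v := by
    have hr : (r + 1 : ℂ) ≠ 0 := Nat.cast_add_one_ne_zero r
    have : (r + 1 : ℂ) • (unitAction (r := r) n V 0 0 P v - (n * P.eval 0 : ℂ) • v) = 0 := by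
      rw [← sub_eq_zero] at hsum
      rw [← hsum, ← Nat.cast_smul_eq_nsmul ℂ]
      module
    exact sub_eq_zero.1 ((smul_eq_zero.1 this).resolve_left hr)
  rw [h, h0]
  split_ifs <;> simp

theorem IsHighestWeight.unitAction_apply_eq_zero (hv : IsHighestWeight V (origin r n) v)
    (a b : Fin (r + 1)) (hb : b ≠ 0) (P : ℂ[X]) : unitAction n V a b P v = 0 := by
  have hdiag := unitAction_diag_apply hv.cartan
  have hup : ∀ a b : Fin (r + 1), a < b → ∀ P, unitAction n V a b P v = 0 := fun a b h P => by
    rw [unitAction_posRoot n V a b h, hv.raising]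
  rcases lt_trichotomy a b with hab | rfl | hab
  · exact hup a b hab P
  · rw [hdiag, if_neg hb, zero_smul]
  · have ha : a ≠ 0 := (lt_of_le_of_lt (Fin.zero_le b) hab).ne'
    obtain ⟨k, hk⟩ := hv.integrable.exists_pow_unitAction_eq_zero n hab
      (mem_weightSpace_topWeight hv.cartan)
    -- For `0 < b < a` the vector `v` has weight zero for the corresponding `sl_2`, so `E_{ab} ⊗ 1`
    -- kills it. The commutator with `E_{aa} ⊗ P`, which also kills `v`, then yields `E_{ab} ⊗ P`.
    have h1 := pow_unitAction_eq_zero n hab.ne (N := 0) hk (hup b a hab 1)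
      (by rw [hdiag, hdiag, if_neg hb, if_neg ha]; simp)
    rw [zero_add, pow_one] at h1
    have h2 := LinearMap.congr_fun (unitAction_mul n V a a a b P 1) v
    simpa [hab.ne, hab.ne', h1, hdiag, ha] using h2.symm

theorem IsHighestWeight.pow_unitAction_apply_eq_zero (hv : IsHighestWeight V (origin r n) v)
    (a : Fin (r + 1)) (ha : a ≠ 0) : (unitAction n V a 0 1 ^ (n + 1)) v = 0 := by
  have hpos : 0 < a := Fin.pos_of_ne_zero ha
  obtain ⟨k, hk⟩ := hv.integrable.exists_pow_unitAction_eq_zero n hpos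
    (mem_weightSpace_topWeight hv.cartan)
  refine pow_unitAction_eq_zero n hpos.ne hk (hv.unitAction_apply_eq_zero 0 a ha 1) ?_
  rw [unitAction_diag_apply hv.cartan, hv.unitAction_apply_eq_zero a a ha]
  simp

theorem unitAction_succ_zero_comm (i j : Fin r) (P Q : ℂ[X]) :
    unitAction n V i.succ 0 P * unitAction n V j.succ 0 Q =
      unitAction n V j.succ 0 Q * unitAction n V i.succ 0 P := by
  simpa [Fin.succ_ne_zero, (Fin.succ_ne_zero _).symm] using
    unitAction_mul n V i.succ 0 j.succ 0 P Q

instance : LeftCommutative fun (j : Fin r) (y : V) => unitAction n V j.succ 0 1 y where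
  left_comm i j y := LinearMap.congr_fun (unitAction_succ_zero_comm i j 1 1) y

variable (n v) in
/-- The result of applying a multiset of commuting lowering operators. -/
noncomputable def lowered (s : Multiset (Fin r)) : V :=
  s.foldr (fun (j : Fin r) (y : V) => unitAction n V j.succ 0 1 y) v

theorem lowered_zero : lowered n v (0 : Multiset (Fin r)) = v := Multiset.foldr_zero _ _

theorem lowered_cons (j : Fin r) (s : Multiset (Fin r)) :
    lowered n v (j ::ₘ s) = unitAction n V j.succ 0 1 (lowered n v s) :=
  Multiset.foldr_cons _ _ _ _

theorem lowered_replicate (k : ℕ) (j : Fin r) :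
    lowered n v (Multiset.replicate k j) = (unitAction n V j.succ 0 1 ^ k) v := by
  induction k with
  | zero => rw [Multiset.replicate_zero, lowered_zero, pow_zero, Module.End.one_apply]
  | succ k ih => rw [Multiset.replicate_succ, lowered_cons, ih, pow_succ', Module.End.mul_apply]

/-- `E_{aj} ⊗ P` kills `v` and its commutator with each factor `E_{j0}` is `E_{a0} ⊗ P`, whence the
multiplicity. For `a = 0` there are further commutators `E_{kj} ⊗ P` and `E_{k0} ⊗ P`, and their
contributions cancel. -/
theorem unitAction_lowered (hv : ∀ (a b : Fin (r + 1)), b ≠ 0 → ∀ P, unitAction n V a b P v = 0)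
    (s : Multiset (Fin r)) (j : Fin r) (a : Fin (r + 1)) (P : ℂ[X]) :
    unitAction n V a j.succ P (lowered n v s) =
      (s.count j : ℂ) • unitAction n V a 0 P (lowered n v (s.erase j)) := by
  induction s using Multiset.induction_on generalizing a P with
  | empty => simp [lowered_zero, hv a j.succ (Fin.succ_ne_zero j)]
  | cons k s ih =>
    have h1 : ∀ y, unitAction n V a j.succ P (unitAction n V k.succ 0 1 y) =
        unitAction n V k.succ 0 1 (unitAction n V a j.succ P y) +
        ((if j = k then unitAction n V a 0 P y else 0) -
          (if a = 0 then unitAction n V k.succ j.succ P y else 0)) := by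
      intro y
      have := LinearMap.congr_fun (unitAction_mul n V a j.succ k.succ 0 P 1) y
      simp only [Module.End.mul_apply, LinearMap.add_apply, LinearMap.sub_apply, mul_one,
        Fin.succ_inj] at this
      rw [this]
      split_ifs <;> rfl
    have h2 : ∀ y, unitAction n V k.succ 0 1 (unitAction n V a 0 P y) =
        unitAction n V a 0 P (unitAction n V k.succ 0 1 y) +
          (if a = 0 then unitAction n V k.succ 0 P y else 0) := by
      intro y
      have := LinearMap.congr_fun (unitAction_mul n V a 0 k.succ 0 P 1) y
      simp only [Module.End.mul_apply, LinearMap.add_apply, LinearMap.sub_apply, mul_one,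
        (Fin.succ_ne_zero _).symm, if_false] at this
      rw [this]
      split_ifs <;> simp
    rw [lowered_cons, h1, ih a, ih k.succ, map_smul, h2, ← lowered_cons]
    by_cases hjk : j = k
    · subst hjk
      rw [if_pos rfl, Multiset.count_cons_self, Multiset.erase_cons_head]
      have h3 : (s.count j : ℂ) • unitAction n V a 0 P (lowered n v (j ::ₘ s.erase j)) =
          (s.count j : ℂ) • unitAction n V a 0 P (lowered n v s) := by
        by_cases hj : j ∈ s
        · rw [Multiset.cons_erase hj]
        · simp [Multiset.count_eq_zero_of_notMem hj]
      rw [smul_add, h3]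
      push_cast
      split_ifs <;> module
    · rw [if_neg hjk, Multiset.count_cons_of_ne hjk, Multiset.erase_cons_tail _ (Ne.symm hjk),
        smul_add]
      split_ifs <;> module

/-- Integrability gives this only for powers of a single operator; the operators `E_{kj} ⊗ 1` then
convert letters `j` into other letters `k`. -/
theorem lowered_eq_zero (hv : ∀ (a b : Fin (r + 1)), b ≠ 0 → ∀ P, unitAction n V a b P v = 0)
    (hpow : ∀ a : Fin (r + 1), a ≠ 0 → (unitAction n V a 0 1 ^ (n + 1)) v = 0)
    {s : Multiset (Fin r)} (hs : s.card = n + 1) : lowered n v s = 0 := by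
  obtain ⟨j, -⟩ := Multiset.card_pos_iff_exists_mem.1 (by omega : 0 < s.card)
  generalize hm : s.card - s.count j = m
  induction m using Nat.strong_induction_on generalizing s with
  | _ m ih =>
    by_cases hrep : s = Multiset.replicate (n + 1) j
    · rw [hrep, lowered_replicate, hpow _ (Fin.succ_ne_zero j)]
    · obtain ⟨k, hk, hkj⟩ : ∃ k ∈ s, k ≠ j := by
        by_contra! h
        exact hrep (Multiset.eq_replicate.2 ⟨hs, h⟩)
      obtain ⟨t, rfl⟩ := Multiset.exists_cons_of_mem hk
      rw [Multiset.card_cons] at hs hm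
      rw [Multiset.count_cons_of_ne hkj.symm] at hm
      have hle := Multiset.count_le_card j t
      have h0 : lowered n v (j ::ₘ t) = 0 := by
        refine ih _ ?_ (by rw [Multiset.card_cons, hs]) rfl
        rw [Multiset.card_cons, Multiset.count_cons_self]
        omega
      -- Applied to the word `j ::ₘ t`, which has fewer letters different from `j`, this operator
      -- gives a nonzero multiple of the word `k ::ₘ t`.
      have h1 := unitAction_lowered hv (j ::ₘ t) j k.succ 1
      rw [h0, map_zero, Multiset.erase_cons_head, Multiset.count_cons_self, ← lowered_cons] at h1
      exact (smul_eq_zero.1 h1.symm).resolve_left (Nat.cast_ne_zero.2 (Nat.succ_ne_zero _))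

/-- The multiset with multiplicities `ν 1, …, ν r`. -/
def tailMultiset (ν : Fin (r + 1) → ℕ) : Multiset (Fin r) := ∑ j : Fin r, ν j.succ • {j}

theorem count_tailMultiset (ν : Fin (r + 1) → ℕ) (j : Fin r) :
    (tailMultiset ν).count j = ν j.succ := by
  simp [tailMultiset, Multiset.count_sum', Multiset.count_singleton]

theorem card_tailMultiset (ν : Fin (r + 1) → ℕ) : (tailMultiset ν).card = ∑ j : Fin r, ν j.succ := by
  simp [tailMultiset]

theorem tailMultiset_add_single_succ (ν : Fin (r + 1) → ℕ) (j : Fin r) :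
    tailMultiset (ν + Pi.single j.succ 1) = j ::ₘ tailMultiset ν := by
  ext k
  rw [count_tailMultiset, Multiset.count_cons, count_tailMultiset]
  simp [Pi.single_apply]

theorem tailMultiset_add_single_zero (ν : Fin (r + 1) → ℕ) :
    tailMultiset (ν + Pi.single 0 1) = tailMultiset ν := by
  ext k
  rw [count_tailMultiset, count_tailMultiset]
  simp

/-- The product of `ν 1 !, …, ν r !`. -/
def tailFactorial (ν : Fin (r + 1) → ℕ) : ℕ := ∏ j : Fin r, (ν j.succ).factorial

theorem tailFactorial_ne_zero (ν : Fin (r + 1) → ℕ) : (tailFactorial ν : ℂ) ≠ 0 :=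
  Nat.cast_ne_zero.2 (Finset.prod_ne_zero_iff.2 fun _ _ => Nat.factorial_ne_zero _)

theorem tailFactorial_add_single_succ (ν : Fin (r + 1) → ℕ) (j : Fin r) :
    tailFactorial (ν + Pi.single j.succ 1) = (ν j.succ + 1) * tailFactorial ν := by
  unfold tailFactorial
  rw [← Finset.mul_prod_erase _ _ (Finset.mem_univ j),
    ← Finset.mul_prod_erase _ (fun j : Fin r => (ν j.succ).factorial) (Finset.mem_univ j),
    ← mul_assoc, ← Nat.factorial_succ]
  congr 1
  · simp
  · refine Finset.prod_congr rfl fun k hk => ?_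
    simp [Finset.ne_of_mem_erase hk]

theorem tailFactorial_add_single_zero (ν : Fin (r + 1) → ℕ) :
    tailFactorial (ν + Pi.single 0 1) = tailFactorial ν := by
  unfold tailFactorial
  simp

variable (n v) in
/-- The result of applying divided powers of the lowering operators. -/
noncomputable def dividedVector (ν : Fin (r + 1) → ℕ) : V :=
  (tailFactorial ν : ℂ)⁻¹ • lowered n v (tailMultiset ν)

/-- The right-hand side does not depend on `b`, which is the source of the relation `swap`. The
divided powers absorb the multiplicity from `unitAction_lowered`. -/
theorem unitAction_dividedVector
    (hv : ∀ (a b : Fin (r + 1)), b ≠ 0 → ∀ P, unitAction n V a b P v = 0)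
    (ν : Fin (r + 1) → ℕ) (a b : Fin (r + 1)) (P : ℂ[X]) :
    unitAction n V a b P (dividedVector n v (ν + Pi.single b 1)) =
      unitAction n V a 0 P (dividedVector n v ν) := by
  unfold dividedVector
  cases b using Fin.cases with
  | zero => rw [tailMultiset_add_single_zero, tailFactorial_add_single_zero]
  | succ j =>
    rw [tailMultiset_add_single_succ, tailFactorial_add_single_succ, map_smul,
      unitAction_lowered hv, Multiset.count_cons_self, Multiset.erase_cons_head,
      count_tailMultiset, smul_smul, map_smul]
    congr 1
    have h1 : ((ν j.succ : ℂ) + 1) ≠ 0 := Nat.cast_add_one_ne_zero _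
    have h2 := tailFactorial_ne_zero ν
    push_cast
    field_simp

theorem IsHighestWeight.isSymmetricFamily (hr : 1 ≤ r)
    (hv : IsHighestWeight V (origin r n) v) :
    IsSymmetricFamily n (unitAction (r := r) n V) (dividedVector (r := r) n v) := by
  have h0 := fun a b hb P => hv.unitAction_apply_eq_zero a b hb P
  have hdiv := unitAction_dividedVector h0
  have hweight : ∀ (ν : Fin (r + 1) → ℕ) (j : Fin r),
      unitAction n V j.succ j.succ 1 (dividedVector n v ν) =
        (ν j.succ : ℂ) • dividedVector n v ν := by
    intro ν j
    unfold dividedVector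
    rw [map_smul, unitAction_lowered h0, count_tailMultiset, smul_comm, ← lowered_cons]
    by_cases hj : j ∈ tailMultiset ν
    · rw [Multiset.cons_erase hj]
    · rw [← count_tailMultiset ν j, Multiset.count_eq_zero_of_notMem hj]
      simp
  refine ⟨unitAction_mul n V, sum_unitAction n V, fun κ _ a b P => ?_, fun ν hν a b P hb => ?_,
    fun ν hν a => ?_⟩
  · rw [hdiv, hdiv]
  · cases b using Fin.cases with
    | zero =>
      -- If `ν 0 = 0`, all `n` units are lowerings and one more gives zero. By `hdiv`, `E_{a0} ⊗ P`
      -- on the original vector factors through this longer one.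
      have hz : dividedVector n v (ν + Pi.single (Fin.succ ⟨0, hr⟩) 1) = 0 := by
        unfold dividedVector
        rw [lowered_eq_zero h0 hv.pow_unitAction_apply_eq_zero, smul_zero]
        rw [tailMultiset_add_single_succ, Multiset.card_cons, card_tailMultiset]
        rw [Fin.sum_univ_succ, hb, zero_add] at hν
        rw [hν]
      rw [← hdiv ν a (Fin.succ ⟨0, hr⟩), hz, map_zero]
    | succ j =>
      unfold dividedVector
      rw [map_smul, unitAction_lowered h0, count_tailMultiset, hb]
      simp
  · cases a using Fin.cases with
    | zero =>
      have hs := LinearMap.congr_fun (sum_unitAction (r := r) n V 1) (dividedVector n v ν)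
      rw [LinearMap.sum_apply, Fin.sum_univ_succ,
        Finset.sum_congr rfl fun j _ => hweight ν j, ← Finset.sum_smul] at hs
      rw [eq_sub_of_add_eq hs, ← hν, Fin.sum_univ_succ]
      simp [add_smul]
    | succ j => exact hweight ν j

theorem dividedVector_single (k : ℕ) :
    dividedVector n v (Pi.single 0 k : Fin (r + 1) → ℕ) = v := by
  have h1 : tailMultiset (Pi.single 0 k : Fin (r + 1) → ℕ) = 0 := by simp [tailMultiset]
  have h2 : tailFactorial (Pi.single 0 k : Fin (r + 1) → ℕ) = 1 := by simp [tailFactorial]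
  rw [dividedVector, h1, h2, lowered_zero]
  simp

theorem IsHighestWeight.iSup_cartanOrbit_eq_top (hr : 1 ≤ r)
    (hv : IsHighestWeight V (origin r n) v) :
    ⨆ ν ∈ Finset.piAntidiag Finset.univ n,
      cartanOrbit (unitAction (r := r) n V) (dividedVector (r := r) n v ν) = ⊤ := by
  refine eq_top_of_unitAction_mem n hv.generates _
    (fun a b P y hy => (hv.isSymmetricFamily hr).mem_iSup_cartanOrbit a b P hy) ?_
  have h : v ∈ cartanOrbit (unitAction (r := r) n V) (dividedVector (r := r) n v (Pi.single 0 n)) := by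
    rw [dividedVector_single]
    exact self_mem_cartanOrbit v
  have hmem : (Pi.single 0 n : Fin (r + 1) → ℕ) ∈ Finset.piAntidiag Finset.univ n := by simp
  exact Submodule.mem_iSup_of_mem _ (Submodule.mem_iSup_of_mem hmem h)

theorem IsHighestWeight.finiteDimensional (hr : 1 ≤ r)
    (hv : IsHighestWeight V (origin r n) v) : FiniteDimensional ℂ V :=
  have : Nontrivial (Fin (r + 1)) := Fin.nontrivial_iff_two_le.2 (by omega)
  (hv.isSymmetricFamily hr).finiteDimensional (hv.iSup_cartanOrbit_eq_top hr)

theorem IsHighestWeight.finrank_le (hr : 1 ≤ r)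
    (hv : IsHighestWeight V (origin r n) v) : Module.finrank ℂ V ≤ (r + 1) ^ n := by
  have : Nontrivial (Fin (r + 1)) := Fin.nontrivial_iff_two_le.2 (by omega)
  simpa using (hv.isSymmetricFamily hr).finrank_le (hv.iSup_cartanOrbit_eq_top hr)

end HighestWeight

/-! ### Cyclic modules and left ideals of the enveloping algebra. -/

section CyclicModules

attribute [local instance 100] LieRing.ofAssociativeRing

/-- By the universal property, `ι` corestricted to the subalgebra extends to the enveloping algebra;
followed by the inclusion, this extension is the identity. -/
theorem adjoin_range_ι (R L : Type*) [CommRing R] [LieRing L] [LieAlgebra R L] :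
    Algebra.adjoin R (Set.range (UniversalEnvelopingAlgebra.ι R : L → _)) = ⊤ := by
  set S := Algebra.adjoin R (Set.range (UniversalEnvelopingAlgebra.ι R : L → _)) with hS
  let g : L →ₗ⁅R⁆ S :=
    { toFun := fun x => ⟨UniversalEnvelopingAlgebra.ι R x, Algebra.subset_adjoin ⟨x, rfl⟩⟩
      map_add' := fun x y => Subtype.ext (map_add _ x y)
      map_smul' := fun c x => Subtype.ext (map_smul _ c x)
      map_lie' := fun {x y} => Subtype.ext (LieHom.map_lie _ x y) }
  have h : S.val.comp (UniversalEnvelopingAlgebra.lift R g) =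
      AlgHom.id R (UniversalEnvelopingAlgebra R L) := by
    apply UniversalEnvelopingAlgebra.hom_ext
    ext x
    simp [g]
  refine eq_top_iff.2 fun u _ => ?_
  have := AlgHom.congr_fun h u
  rw [← AlgHom.id_apply (R := R) u, ← this]
  exact (UniversalEnvelopingAlgebra.lift R g u).2

variable {r : ℕ} {A : Type} [CommRing A] [Algebra ℂ A] (J : Ideal (Env r A))

theorem Cyclic.mk_eq_smul_vec (u : Env r A) :
    (Submodule.Quotient.mk u : Cyclic J) = u • Cyclic.vec J := by
  change _ = Submodule.Quotient.mk (u • (1 : Env r A))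
  rw [smul_eq_mul, mul_one]

theorem Cyclic.lieSpan_vec :
    LieSubmodule.lieSpan ℂ (Current r A) {Cyclic.vec J} = ⊤ := by
  have h : ∀ u : Env r A, u • Cyclic.vec J ∈
      LieSubmodule.lieSpan ℂ (Current r A) {Cyclic.vec J} := by
    have h2 : ∀ u : Env r A, ∀ m ∈ LieSubmodule.lieSpan ℂ (Current r A) {Cyclic.vec J},
        u • m ∈ LieSubmodule.lieSpan ℂ (Current r A) {Cyclic.vec J} := by
      intro u
      have hu : u ∈ Algebra.adjoin ℂ (Set.range
          (UniversalEnvelopingAlgebra.ι ℂ : Current r A → Env r A)) :=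
        adjoin_range_ι ℂ (Current r A) ▸ Algebra.mem_top
      induction hu using Algebra.adjoin_induction with
      | mem u hu =>
        obtain ⟨x, rfl⟩ := hu
        intro m hm
        rw [← Cyclic.lie_def]
        exact LieSubmodule.lie_mem _ hm
      | algebraMap c =>
        intro m hm
        rw [algebraMap_smul]
        exact (LieSubmodule.lieSpan ℂ (Current r A) {Cyclic.vec J}).smul_mem c hm
      | add u u' _ _ hu hu' =>
        intro m hm
        rw [add_smul]
        exact add_mem (hu m hm) (hu' m hm)
      | mul u u' _ _ hu hu' =>
        intro m hm
        rw [mul_smul]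
        exact hu _ (hu' m hm)
    exact fun u => h2 u _ (LieSubmodule.subset_lieSpan rfl)
  refine eq_top_iff.2 fun m _ => ?_
  obtain ⟨u, rfl⟩ := Submodule.Quotient.mk_surjective J m
  exact Cyclic.mk_eq_smul_vec J u ▸ h u

variable {J}

theorem Cyclic.lie_vec_eq_smul {x : Current r A} {c : ℂ} :
    ⁅x, Cyclic.vec J⁆ = c • Cyclic.vec J ↔
      UniversalEnvelopingAlgebra.ι ℂ x - algebraMap ℂ (Env r A) c ∈ J := by
  rw [Cyclic.lie_def, ← algebraMap_smul (Env r A) c, ← Cyclic.mk_eq_smul_vec,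
    ← Cyclic.mk_eq_smul_vec]
  exact Submodule.Quotient.eq J

theorem Cyclic.lie_vec_eq_zero {x : Current r A} :
    ⁅x, Cyclic.vec J⁆ = 0 ↔ UniversalEnvelopingAlgebra.ι ℂ x ∈ J := by
  have := Cyclic.lie_vec_eq_smul (J := J) (x := x) (c := 0)
  simpa using this

/-- The conditions on a left ideal under which the class of `1` in the quotient has the
properties of the highest weight vector. -/
structure IsHighestWeightIdeal (Z : Fin r → Multiset (A →ₐ[ℂ] ℂ)) (J : Ideal (Env r A)) : Prop where
  raising : ∀ (i j : Fin (r + 1)) (h : i < j) (P : A),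
    UniversalEnvelopingAlgebra.ι ℂ (P ⊗ₜ[ℂ] posRoot i j h : Current r A) ∈ J
  cartan : ∀ (i : Fin r) (P : A),
    UniversalEnvelopingAlgebra.ι ℂ (P ⊗ₜ[ℂ] coroot i : Current r A) -
      algebraMap ℂ (Env r A) ((Z i).map fun z => z P).sum ∈ J

theorem IsHighestWeight.isHighestWeightIdeal {Z : Fin r → Multiset (A →ₐ[ℂ] ℂ)}
    (h : IsHighestWeight (Cyclic J) Z (Cyclic.vec J)) : IsHighestWeightIdeal Z J where
  raising i j hij P := Cyclic.lie_vec_eq_zero.1 (h.raising i j hij P)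
  cartan i P := Cyclic.lie_vec_eq_smul.1 (h.cartan i P)

theorem IsHighestWeightIdeal.inf {Z : Fin r → Multiset (A →ₐ[ℂ] ℂ)} {J' : Ideal (Env r A)}
    (h : IsHighestWeightIdeal Z J) (h' : IsHighestWeightIdeal Z J') :
    IsHighestWeightIdeal Z (J ⊓ J') where
  raising i j hij P := ⟨h.raising i j hij P, h'.raising i j hij P⟩
  cartan i P := ⟨h.cartan i P, h'.cartan i P⟩

/-- Integrability is automatic in finite dimension. This lets ideals be intersected without checking
integrability separately. -/
theorem IsHighestWeightIdeal.isHighestWeight {n : ℕ} {J : Ideal (Env r ℂ[X])}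
    (h : IsHighestWeightIdeal (origin r n) J) [FiniteDimensional ℂ (Cyclic J)] :
    IsHighestWeight (Cyclic J) (origin r n) (Cyclic.vec J) where
  integrable := isIntegrable_of_finiteDimensional (Cyclic.lieSpan_vec J)
    (mem_weightSpace_topWeight fun i P => Cyclic.lie_vec_eq_smul.2 (h.cartan i P))
  generates := Cyclic.lieSpan_vec J
  raising i j hij P := Cyclic.lie_vec_eq_zero.2 (h.raising i j hij P)
  cartan i P := Cyclic.lie_vec_eq_smul.2 (h.cartan i P)

theorem Cyclic.finiteDimensional_inf {J' : Ideal (Env r A)} [FiniteDimensional ℂ (Cyclic J)]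
    [FiniteDimensional ℂ (Cyclic J')] : FiniteDimensional ℂ (Cyclic (J ⊓ J')) := by
  let f : (Env r A ⧸ J ⊓ J') →ₗ[Env r A] (Env r A ⧸ J) × (Env r A ⧸ J') :=
    (J ⊓ J').liftQ ((Submodule.mkQ J).prod (Submodule.mkQ J')) (by
      rw [LinearMap.ker_prod, Submodule.ker_mkQ, Submodule.ker_mkQ])
  have hf : Function.Injective f := by
    rw [← LinearMap.ker_eq_bot]
    refine Submodule.ker_liftQ_eq_bot _ _ _ ?_
    rw [LinearMap.ker_prod, Submodule.ker_mkQ, Submodule.ker_mkQ]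
  let g : Cyclic (J ⊓ J') →ₗ[ℂ] Cyclic J × Cyclic J' :=
    { toFun := f
      map_add' := map_add f
      map_smul' := fun c m => f.map_smul_of_tower c m }
  have hg : Function.Injective g := hf
  exact Module.Finite.of_injective g hg

/-- Comparison of left ideals through the dimensions of the quotients. -/
theorem Cyclic.le_of_finrank_inf_le {J' : Ideal (Env r A)} [FiniteDimensional ℂ (Cyclic (J ⊓ J'))]
    (h : Module.finrank ℂ (Cyclic (J ⊓ J')) ≤ Module.finrank ℂ (Cyclic J)) : J ≤ J' := by
  let f : (Env r A ⧸ J ⊓ J') →ₗ[Env r A] Env r A ⧸ J := Submodule.factor inf_le_left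
  let g : Cyclic (J ⊓ J') →ₗ[ℂ] Cyclic J :=
    { toFun := f
      map_add' := map_add f
      map_smul' := fun c m => f.map_smul_of_tower c m }
  have hg : Function.Surjective g := fun m => by
    obtain ⟨u, rfl⟩ := Submodule.Quotient.mk_surjective J m
    exact ⟨Submodule.Quotient.mk u, rfl⟩
  have hfin : FiniteDimensional ℂ (Cyclic J) := Module.Finite.of_surjective g hg
  have hinj : Function.Injective g :=
    (LinearMap.injective_iff_surjective_of_finrank_eq_finrank
      (le_antisymm h (LinearMap.finrank_le_finrank_of_surjective hg))).2 hg
  intro u hu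
  have h0 : g (Submodule.Quotient.mk u) = 0 := (Submodule.Quotient.mk_eq_zero J).2 hu
  have h1 := hinj (h0.trans (map_zero g).symm)
  exact ((Submodule.Quotient.mk_eq_zero (J ⊓ J')).1 h1).2

section Annihilator

variable {V : Type*} [AddCommGroup V] [Module ℂ V]
  [LieRingModule (Current r A) V] [LieModule ℂ (Current r A) V] (v : V)

/-- The action of the enveloping algebra on a vector. -/
noncomputable def envApply : Env r A →ₗ[ℂ] V :=
  (LinearMap.applyₗ v).comp
    (UniversalEnvelopingAlgebra.lift ℂ (LieModule.toEnd ℂ (Current r A) V)).toLinearMap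

theorem envApply_one : envApply v (1 : Env r A) = v := by
  change (UniversalEnvelopingAlgebra.lift ℂ (LieModule.toEnd ℂ (Current r A) V)) 1 v = v
  rw [map_one, Module.End.one_apply]

theorem envApply_mul (u u' : Env r A) : envApply v (u * u') =
    UniversalEnvelopingAlgebra.lift ℂ (LieModule.toEnd ℂ (Current r A) V) u (envApply v u') := by
  change (UniversalEnvelopingAlgebra.lift ℂ (LieModule.toEnd ℂ (Current r A) V)) (u * u') v = _
  rw [map_mul, Module.End.mul_apply]
  rfl

theorem envApply_ι_mul (x : Current r A) (u : Env r A) :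
    envApply v (UniversalEnvelopingAlgebra.ι ℂ x * u) = ⁅x, envApply v u⁆ := by
  rw [envApply_mul, UniversalEnvelopingAlgebra.lift_ι_apply]
  rfl

theorem envApply_ι (x : Current r A) :
    envApply v (UniversalEnvelopingAlgebra.ι ℂ x : Env r A) = ⁅x, v⁆ := by
  rw [← mul_one (UniversalEnvelopingAlgebra.ι ℂ x : Env r A), envApply_ι_mul, envApply_one]

theorem envApply_algebraMap (c : ℂ) : envApply v (algebraMap ℂ (Env r A) c) = c • v := by
  rw [Algebra.algebraMap_eq_smul_one, map_smul, envApply_one]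

variable (r A) in
/-- The left ideal of the elements that annihilate a vector. -/
noncomputable def annihilatorIdeal : Ideal (Env r A) where
  carrier := {u | envApply v u = 0}
  add_mem' {u u'} hu hu' := by
    change envApply v (u + u') = 0
    rw [map_add, hu, hu', add_zero]
  zero_mem' := map_zero _
  smul_mem' u u' hu := by
    change envApply v (u * u') = 0
    rw [envApply_mul, hu, map_zero]

theorem mem_annihilatorIdeal {u : Env r A} : u ∈ annihilatorIdeal r A v ↔ envApply v u = 0 :=
  Iff.rfl

variable {v} in
/-- The homomorphism from a cyclic module that takes the generator to a given vector. -/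
noncomputable def Cyclic.lift (h : J ≤ annihilatorIdeal r A v) :
    Cyclic J →ₗ⁅ℂ, Current r A⁆ V :=
  { ((J.restrictScalars ℂ).liftQ (envApply v) h).comp
      (Submodule.Quotient.restrictScalarsEquiv ℂ J).symm.toLinearMap with
    map_lie' := fun {x m} => by
      obtain ⟨u, rfl⟩ := Submodule.Quotient.mk_surjective J m
      exact envApply_ι_mul v x u }

theorem Cyclic.lift_vec (h : J ≤ annihilatorIdeal r A v) :
    Cyclic.lift h (Cyclic.vec J) = v := envApply_one v

theorem Cyclic.lift_surjective (h : J ≤ annihilatorIdeal r A v)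
    (hv : LieSubmodule.lieSpan ℂ (Current r A) {v} = ⊤) :
    Function.Surjective (Cyclic.lift h) := by
  rw [← LieModuleHom.range_eq_top, eq_top_iff, ← hv, LieSubmodule.lieSpan_le,
    Set.singleton_subset_iff]
  exact ⟨Cyclic.vec J, Cyclic.lift_vec v h⟩

theorem Cyclic.lift_injective :
    Function.Injective (Cyclic.lift (le_refl (annihilatorIdeal r A v))) := by
  rw [injective_iff_map_eq_zero]
  intro m hm
  obtain ⟨u, rfl⟩ := Submodule.Quotient.mk_surjective _ m
  exact (Submodule.Quotient.mk_eq_zero _).2 hm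

theorem IsHighestWeight.annihilatorIdeal {Z : Fin r → Multiset (A →ₐ[ℂ] ℂ)}
    (h : IsHighestWeight V Z v) : IsHighestWeightIdeal Z (annihilatorIdeal r A v) where
  raising i j hij P := by
    rw [mem_annihilatorIdeal, envApply_ι, h.raising]
  cartan i P := by
    rw [mem_annihilatorIdeal, map_sub, envApply_ι, h.cartan, envApply_algebraMap, sub_self]

end Annihilator

end CyclicModules

/-! ### The tensor product of evaluation modules at the points `0, t, …, (n-1)t`. -/

section Model

attribute [local instance 100] LieRing.ofAssociativeRing

/-- The `n`-th tensor power of `ℂ[t]^{r+1}`, as functions on words. -/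
abbrev WordSpace (r n : ℕ) : Type := (Fin n → Fin (r + 1)) → ℂ[X]

variable {r n : ℕ}

/-- The action of a matrix on one tensor factor. -/
noncomputable def siteAction (k : Fin n) :
    Matrix (Fin (r + 1)) (Fin (r + 1)) ℂ →ₗ[ℂ] Module.End ℂ[X] (WordSpace r n) where
  toFun y :=
    { toFun := fun φ w => ∑ b, Polynomial.C (y (w k) b) * φ (Function.update w k b)
      map_add' := fun φ ψ => by
        ext1 w
        simp only [Pi.add_apply, mul_add, Finset.sum_add_distrib]
      map_smul' := fun p φ => by
        ext1 w
        simp only [Pi.smul_apply, smul_eq_mul, Finset.mul_sum, RingHom.id_apply, mul_left_comm] }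
  map_add' y z := by
    refine LinearMap.ext fun φ => funext fun w => ?_
    simp only [LinearMap.coe_mk, AddHom.coe_mk, LinearMap.add_apply, Pi.add_apply,
      Matrix.add_apply, map_add, add_mul, Finset.sum_add_distrib]
  map_smul' c y := by
    refine LinearMap.ext fun φ => funext fun w => ?_
    simp only [LinearMap.coe_mk, AddHom.coe_mk, LinearMap.smul_apply, Pi.smul_apply,
      Matrix.smul_apply, smul_eq_mul, map_mul, RingHom.id_apply, Finset.smul_sum,
      Polynomial.smul_eq_C_mul, mul_assoc]

theorem siteAction_apply (k : Fin n) (y : Matrix (Fin (r + 1)) (Fin (r + 1)) ℂ)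
    (φ : WordSpace r n) (w : Fin n → Fin (r + 1)) :
    siteAction k y φ w = ∑ b, Polynomial.C (y (w k) b) * φ (Function.update w k b) := rfl

theorem siteAction_mul (k : Fin n) (y z : Matrix (Fin (r + 1)) (Fin (r + 1)) ℂ) :
    siteAction k (y * z) = siteAction k y * siteAction k z := by
  refine LinearMap.ext fun φ => funext fun w => ?_
  simp only [Module.End.mul_apply, siteAction_apply, Function.update_self, Function.update_idem,
    Matrix.mul_apply, map_sum, map_mul, Finset.sum_mul, Finset.mul_sum, mul_assoc]
  exact Finset.sum_comm

theorem siteAction_commute {k l : Fin n} (hkl : k ≠ l)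
    (y z : Matrix (Fin (r + 1)) (Fin (r + 1)) ℂ) :
    siteAction k y * siteAction l z = siteAction l z * siteAction k y := by
  refine LinearMap.ext fun φ => funext fun w => ?_
  simp only [Module.End.mul_apply, siteAction_apply, Function.update_of_ne hkl,
    Function.update_of_ne hkl.symm, Finset.mul_sum]
  rw [Finset.sum_comm]
  refine Finset.sum_congr rfl fun b _ => Finset.sum_congr rfl fun c _ => ?_
  rw [Function.update_comm hkl, mul_left_comm]

theorem siteAction_single (k : Fin n) (a b : Fin (r + 1)) (w : Fin n → Fin (r + 1)) :
    siteAction k (Matrix.single a b 1) (Pi.single w 1 : WordSpace r n) =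
      if w k = b then Pi.single (Function.update w k a) 1 else 0 := by
  ext1 w'
  rw [siteAction_apply, Finset.sum_eq_single b]
  · by_cases h : w k = b ∧ w' = Function.update w k a
    · obtain ⟨rfl, rfl⟩ := h
      simp
    · have h2 : a = w' k → Function.update w' k b ≠ w := by
        rintro rfl rfl
        exact h ⟨by simp, by simp⟩
      by_cases ha : a = w' k
      · rw [Pi.single_eq_of_ne (h2 ha), mul_zero]
        split_ifs with hb
        · rw [Pi.single_eq_of_ne fun h' => h ⟨hb, h'⟩]
        · rfl
      · rw [Matrix.single_apply_of_row_ne ha, map_zero, zero_mul]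
        split_ifs with hb
        · rw [Pi.single_eq_of_ne fun h' => h ⟨hb, h'⟩]
        · rfl
  · intro c _ hc
    rw [Matrix.single_apply_of_col_ne _ _ hc.symm, map_zero, zero_mul]
  · simp

/-- The evaluation of a polynomial at the point `k t` of the affine line over `ℂ[t]`. -/
noncomputable def sitePoint (k : Fin n) : ℂ[X] →ₐ[ℂ] ℂ[X] :=
  Polynomial.aeval (((k : ℕ) : ℂ) • (Polynomial.X : ℂ[X]))

variable (r n) in
/-- The linear map underlying the action on the tensor product of the evaluation modules. -/
noncomputable def modelLinear : Current r ℂ[X] →ₗ[ℂ] Module.End ℂ[X] (WordSpace r n) :=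
  TensorProduct.lift (LinearMap.mk₂ ℂ
    (fun (P : ℂ[X]) (y : sl (Fin (r + 1)) ℂ) =>
      ∑ k : Fin n, sitePoint k P • siteAction k y.val)
    (fun P Q y => by simp only [map_add, add_smul, Finset.sum_add_distrib])
    (fun c P y => by simp only [map_smul, smul_assoc, Finset.smul_sum])
    (fun P y z => by
      change ∑ k : Fin n, sitePoint k P • siteAction k (y.val + z.val) = _
      simp only [map_add, smul_add, Finset.sum_add_distrib])
    (fun c P y => by
      change ∑ k : Fin n, sitePoint k P • siteAction k (c • y.val) = _
      simp only [map_smul, Finset.smul_sum, smul_comm c]))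

theorem modelLinear_tmul (P : ℂ[X]) (y : sl (Fin (r + 1)) ℂ) :
    modelLinear r n (P ⊗ₜ y) = ∑ k : Fin n, sitePoint k P • siteAction k y.val := rfl

theorem modelLinear_lie_tmul (P Q : ℂ[X]) (y z : sl (Fin (r + 1)) ℂ) :
    modelLinear r n ⁅(P ⊗ₜ[ℂ] y : Current r ℂ[X]), (Q ⊗ₜ[ℂ] z : Current r ℂ[X])⁆ =
      modelLinear r n (P ⊗ₜ y) * modelLinear r n (Q ⊗ₜ z) -
        modelLinear r n (Q ⊗ₜ z) * modelLinear r n (P ⊗ₜ y) := by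
  rw [LieAlgebra.ExtendScalars.bracket_tmul, modelLinear_tmul, modelLinear_tmul, modelLinear_tmul,
    sl_bracket, Finset.sum_mul_sum, Finset.sum_mul_sum,
    Finset.sum_comm (f := fun i j : Fin n => (sitePoint i Q • siteAction i z.val) * _),
    ← Finset.sum_sub_distrib]
  refine Finset.sum_congr rfl fun k _ => ?_
  rw [← Finset.sum_sub_distrib, Finset.sum_eq_single k]
  · rw [map_sub, siteAction_mul, siteAction_mul, map_mul, smul_mul_smul_comm,
      smul_mul_smul_comm, mul_comm (sitePoint k Q), smul_sub]
  · intro l _ hl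
    rw [smul_mul_smul_comm, smul_mul_smul_comm, siteAction_commute hl.symm,
      mul_comm (sitePoint l Q), sub_self]
  · simp

/-- The action of `sl_{r+1} ⊗ ℂ[X]` on the tensor product of the evaluation modules at the points
`k t`. -/
noncomputable def modelAction (r n : ℕ) :
    Current r ℂ[X] →ₗ⁅ℂ⁆ Module.End ℂ[X] (WordSpace r n) :=
  { modelLinear r n with
    map_lie' := fun {x x'} => by
      change modelLinear r n _ = modelLinear r n x * modelLinear r n x' -
        modelLinear r n x' * modelLinear r n x
      induction x using TensorProduct.induction_on with
      | zero => rw [zero_lie, map_zero, zero_mul, mul_zero, sub_zero]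
      | add x₁ x₂ h₁ h₂ =>
        rw [add_lie, map_add, map_add, add_mul, mul_add, h₁, h₂]
        abel
      | tmul P y =>
        induction x' using TensorProduct.induction_on with
        | zero => rw [lie_zero, map_zero, zero_mul, mul_zero, sub_zero]
        | add x₁ x₂ h₁ h₂ =>
          rw [lie_add, map_add, map_add, add_mul, mul_add, h₁, h₂]
          abel
        | tmul Q z => exact modelLinear_lie_tmul P Q y z }

theorem modelAction_tmul (P : ℂ[X]) (y : sl (Fin (r + 1)) ℂ) :
    modelAction r n (P ⊗ₜ y) = ∑ k : Fin n, sitePoint k P • siteAction k y.val := rfl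

/-- The action of the enveloping algebra on the model. -/
noncomputable def modelEnv (r n : ℕ) : Env r ℂ[X] →ₐ[ℂ] Module.End ℂ[X] (WordSpace r n) :=
  UniversalEnvelopingAlgebra.lift ℂ (modelAction r n)

theorem modelEnv_ι (x : Current r ℂ[X]) :
    modelEnv r n (UniversalEnvelopingAlgebra.ι ℂ x) = modelAction r n x :=
  UniversalEnvelopingAlgebra.lift_ι_apply _ _ _

/-- The highest weight vector of the model. -/
noncomputable def modelVec (r n : ℕ) : WordSpace r n := Pi.single 0 1

/-- The lattice over `ℂ[t]` generated by the highest weight vector. -/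
noncomputable def modelLattice (r n : ℕ) : Submodule ℂ[X] (WordSpace r n) :=
  Submodule.span ℂ[X] (Set.range fun u => modelEnv r n u (modelVec r n))

theorem modelEnv_mem_modelLattice (u : Env r ℂ[X]) :
    modelEnv r n u (modelVec r n) ∈ modelLattice r n := Submodule.subset_span ⟨u, rfl⟩

theorem modelEnv_apply_mem_modelLattice (u : Env r ℂ[X]) {φ : WordSpace r n}
    (hφ : φ ∈ modelLattice r n) : modelEnv r n u φ ∈ modelLattice r n := by
  revert φ
  change modelLattice r n ≤ (modelLattice r n).comap (modelEnv r n u)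
  rw [modelLattice, Submodule.span_le]
  rintro _ ⟨u', rfl⟩
  refine Submodule.subset_span ⟨u * u', ?_⟩
  change modelEnv r n (u * u') _ = _
  rw [map_mul, Module.End.mul_apply]

/-- The left ideal of the elements that take the highest weight vector to `t` times the lattice. -/
noncomputable def modelIdeal (r n : ℕ) : Ideal (Env r ℂ[X]) where
  carrier := {u | ∃ φ ∈ modelLattice r n,
    modelEnv r n u (modelVec r n) = (Polynomial.X : ℂ[X]) • φ}
  add_mem' := by
    rintro u u' ⟨φ, hφ, h⟩ ⟨φ', hφ', h'⟩
    exact ⟨φ + φ', add_mem hφ hφ', by rw [map_add, LinearMap.add_apply, h, h', smul_add]⟩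
  zero_mem' := ⟨0, zero_mem _, by simp⟩
  smul_mem' := by
    rintro u u' ⟨φ, hφ, h⟩
    exact ⟨modelEnv r n u φ, modelEnv_apply_mem_modelLattice u hφ,
      by rw [smul_eq_mul, map_mul, Module.End.mul_apply, h, map_smul]⟩

theorem mem_modelIdeal {u : Env r ℂ[X]} : u ∈ modelIdeal r n ↔ ∃ φ ∈ modelLattice r n,
    modelEnv r n u (modelVec r n) = (Polynomial.X : ℂ[X]) • φ := Iff.rfl

theorem siteAction_single_modelVec (k : Fin n) (a b : Fin (r + 1)) (hb : b ≠ 0) :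
    siteAction k (Matrix.single a b 1) (modelVec r n) = 0 := by
  rw [modelVec, siteAction_single, if_neg]
  exact hb.symm

theorem siteAction_single_zero_modelVec (k : Fin n) :
    siteAction k (Matrix.single 0 0 1) (modelVec r n) = modelVec r n := by
  rw [modelVec, siteAction_single, if_pos (Pi.zero_apply k)]
  congr 1
  exact Function.update_eq_self k _

theorem isHighestWeightIdeal_modelIdeal :
    IsHighestWeightIdeal (origin r n) (modelIdeal r n) where
  raising i j hij P := by
    refine ⟨0, zero_mem _, ?_⟩
    rw [modelEnv_ι, modelAction_tmul, smul_zero, LinearMap.sum_apply]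
    refine Finset.sum_eq_zero fun k _ => ?_
    have h : siteAction k (posRoot i j hij).val (modelVec r n) = 0 :=
      siteAction_single_modelVec k i j (lt_of_le_of_lt (Fin.zero_le i) hij).ne'
    rw [LinearMap.smul_apply, h, smul_zero]
  cartan i P := by
    rw [sum_map_origin, mem_modelIdeal, map_sub, LinearMap.sub_apply, modelEnv_ι, modelAction_tmul,
      AlgHom.commutes, Module.algebraMap_end_apply, LinearMap.sum_apply]
    have h : ∀ k : Fin n, (sitePoint k P • siteAction k (coroot i).val) (modelVec r n) =
        (if (i : ℕ) = 0 then sitePoint k P else 0) • modelVec r n := by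
      intro k
      rw [LinearMap.smul_apply, coroot, val_singleSubSingle, map_sub, LinearMap.sub_apply,
        siteAction_single_modelVec k i.succ i.succ (Fin.succ_ne_zero i), sub_zero]
      split_ifs with hi
      · have : i.castSucc = 0 := Fin.ext hi
        rw [this, siteAction_single_zero_modelVec]
      · rw [siteAction_single_modelVec k _ _ fun h => hi (congrArg Fin.val h), smul_zero, zero_smul]
    rw [Finset.sum_congr rfl fun k _ => h k]
    split_ifs with hi
    -- At `t = 0` all `n` points collide at the origin, so the eigenvalue `∑ P(k t)` becomes `n
    -- P(0)`.
    · have hdvd : (Polynomial.X : ℂ[X]) ∣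
          ∑ k : Fin n, sitePoint k P - Polynomial.C (n * P.eval 0) := by
        rw [Polynomial.X_dvd_iff, Polynomial.coeff_sub, Polynomial.coeff_C_zero,
          Polynomial.finsetSum_coeff]
        have : ∀ k : Fin n, (sitePoint k P).coeff 0 = P.eval 0 := by
          intro k
          rw [Polynomial.coeff_zero_eq_eval_zero, sitePoint, Polynomial.aeval_def,
            Polynomial.algebraMap_eq, ← Polynomial.comp, Polynomial.eval_comp]
          simp
        simp [this]
      obtain ⟨q, hq⟩ := hdvd
      refine ⟨q • modelVec r n, Submodule.smul_mem _ _ ?_, ?_⟩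
      · simpa using modelEnv_mem_modelLattice (r := r) (n := n) 1
      · rw [smul_smul, ← hq, sub_smul, Finset.sum_smul, Polynomial.C_eq_algebraMap, algebraMap_smul]
    · exact ⟨0, zero_mem _, by simp⟩

end Model

/-! ### Rank of the lattice and its fibre at `t = 0`. -/

section LatticeRank

attribute [local instance 100] LieRing.ofAssociativeRing

variable {r n : ℕ}

/-- The lattice is a `ℂ[t]`-module, so the current polynomial may have coefficients in `ℂ[t]`. This
permits interpolation at nodes depending on `t`. -/
theorem sum_eval_smul_siteAction_mem (q : ℂ[X][X]) (y : sl (Fin (r + 1)) ℂ) {φ : WordSpace r n}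
    (hφ : φ ∈ modelLattice r n) :
    ∑ l : Fin n, q.eval (((l : ℕ) : ℂ) • (Polynomial.X : ℂ[X])) • siteAction l y.val φ ∈
      modelLattice r n := by
  have h : ∑ l : Fin n, q.eval (((l : ℕ) : ℂ) • (Polynomial.X : ℂ[X])) • siteAction l y.val φ =
      ∑ i ∈ Finset.range (q.natDegree + 1), q.coeff i •
        modelEnv r n (UniversalEnvelopingAlgebra.ι ℂ
          ((Polynomial.X ^ i : ℂ[X]) ⊗ₜ[ℂ] y : Current r ℂ[X])) φ := by
    simp only [Polynomial.eval_eq_sum_range, Finset.sum_smul, modelEnv_ι, modelAction_tmul,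
      LinearMap.sum_apply, LinearMap.smul_apply, Finset.smul_sum, smul_smul]
    rw [Finset.sum_comm]
    simp [sitePoint]
  rw [h]
  exact sum_mem fun i _ => Submodule.smul_mem _ _ (modelEnv_apply_mem_modelLattice _ hφ)

/-- Lagrange interpolation separates the tensor factors up to a power of `t`. -/
theorem pow_smul_siteAction_mem (k : Fin n) (y : sl (Fin (r + 1)) ℂ) {φ : WordSpace r n}
    (hφ : φ ∈ modelLattice r n) :
    (Polynomial.X ^ (n - 1) : ℂ[X]) • siteAction k y.val φ ∈ modelLattice r n := by
  let z : Fin n → ℂ[X] := fun l => ((l : ℕ) : ℂ) • (Polynomial.X : ℂ[X])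
  -- `q` vanishes at every node but the `k`-th, where its value is a nonzero constant times
  -- `t^{n-1}`.
  let q : ℂ[X][X] := ∏ l ∈ Finset.univ.erase k, (Polynomial.X - Polynomial.C (z l))
  have hmem := sum_eval_smul_siteAction_mem q y hφ
  let c : ℂ := ∏ l ∈ Finset.univ.erase k, (((k : ℕ) : ℂ) - ((l : ℕ) : ℂ))
  have hc : c ≠ 0 := by
    refine Finset.prod_ne_zero_iff.2 fun l hl => sub_ne_zero.2 fun h => ?_
    exact Finset.ne_of_mem_erase hl (Fin.ext (Nat.cast_injective h)).symm
  have hk : q.eval (z k) = c • Polynomial.X ^ (n - 1) := by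
    have : ∀ l ∈ Finset.univ.erase k, (Polynomial.X - Polynomial.C (z l)).eval (z k) =
        Polynomial.C (((k : ℕ) : ℂ) - ((l : ℕ) : ℂ)) * Polynomial.X := by
      intro l _
      rw [Polynomial.eval_sub, Polynomial.eval_X, Polynomial.eval_C, ← Polynomial.smul_eq_C_mul,
        sub_smul]
    rw [Polynomial.eval_prod, Finset.prod_congr rfl this, Finset.prod_mul_distrib,
      Finset.prod_const, Finset.card_erase_of_mem (Finset.mem_univ k), Finset.card_univ,
      Fintype.card_fin, ← map_prod, Polynomial.smul_eq_C_mul]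
  have hl : ∀ l ∈ (Finset.univ : Finset (Fin n)), l ≠ k →
      q.eval (z l) • siteAction l y.val φ = 0 := by
    intro l _ hlk
    have : q.eval (z l) = 0 := by
      rw [Polynomial.eval_prod]
      refine Finset.prod_eq_zero (Finset.mem_erase.2 ⟨hlk, Finset.mem_univ l⟩) ?_
      rw [Polynomial.eval_sub, Polynomial.eval_X, Polynomial.eval_C, sub_self]
    rw [this, zero_smul]
  change ∑ l : Fin n, q.eval (z l) • siteAction l y.val φ ∈ _ at hmem
  rw [Finset.sum_eq_single k hl (by simp), hk] at hmem
  have h2 := (modelLattice r n).smul_mem (Polynomial.C c⁻¹) hmem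
  rwa [smul_smul, ← Polynomial.smul_eq_C_mul, smul_smul, inv_mul_cancel₀ hc, one_smul] at h2

/-- Starting from the constant word `0`, the letters are set one site at a time by `E_{w k, 0}`,
each change costing a factor `t^{n-1}`. -/
theorem exists_pow_smul_single_mem (w : Fin n → Fin (r + 1)) :
    ∃ m, (Polynomial.X ^ m : ℂ[X]) • (Pi.single w 1 : WordSpace r n) ∈ modelLattice r n := by
  have key : ∀ S : Finset (Fin n), ∃ m, (Polynomial.X ^ m : ℂ[X]) •
      (Pi.single (fun k => if k ∈ S then w k else 0) 1 : WordSpace r n) ∈ modelLattice r n := by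
    intro S
    induction S using Finset.induction_on with
    | empty =>
      refine ⟨0, ?_⟩
      have := modelEnv_mem_modelLattice (r := r) (n := n) 1
      rw [map_one, Module.End.one_apply] at this
      simp only [Finset.notMem_empty, if_false, pow_zero, one_smul]
      exact this
    | insert k S hk ih =>
      obtain ⟨m, hm⟩ := ih
      have hupd : (fun l => if l ∈ insert k S then w l else 0) =
          Function.update (fun l => if l ∈ S then w l else 0) k (w k) := by
        ext1 l
        by_cases hl : l = k
        · subst hl; simp
        · simp [hl]
      by_cases hw : w k = 0
      · refine ⟨m, ?_⟩
        rw [hupd, hw, Function.update_eq_self_iff.2 (by simp [hk])]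
        exact hm
      · refine ⟨n - 1 + m, ?_⟩
        have h := pow_smul_siteAction_mem k (single (w k) 0 hw 1) hm
        rw [val_single, map_smul, siteAction_single, if_pos (by simp [hk]), smul_smul,
          ← pow_add] at h
        rwa [hupd]
  simpa using key Finset.univ

theorem exists_pow_smul_mem :
    ∃ m, ∀ φ : WordSpace r n, (Polynomial.X ^ m : ℂ[X]) • φ ∈ modelLattice r n := by
  choose m hm using exists_pow_smul_single_mem (r := r) (n := n)
  refine ⟨∑ w, m w, fun φ => ?_⟩
  have : φ = ∑ w, φ w • (Pi.single w 1 : WordSpace r n) := by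
    simp only [← Pi.single_smul, smul_eq_mul, mul_one]
    exact (Finset.univ_sum_single φ).symm
  rw [this, Finset.smul_sum]
  refine sum_mem fun w _ => ?_
  rw [smul_comm, ← Finset.sum_erase_add _ _ (Finset.mem_univ w), pow_add, mul_smul]
  exact Submodule.smul_mem _ _ (Submodule.smul_mem _ _ (hm w))

theorem finrank_modelLattice : Module.finrank ℂ[X] (modelLattice r n) = (r + 1) ^ n := by
  have hT : Module.finrank ℂ[X] (WordSpace r n) = (r + 1) ^ n := by
    rw [Module.finrank_fintype_fun_eq_card]
    simp
  rw [← hT]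
  refine le_antisymm (Submodule.finrank_le _) ?_
  obtain ⟨m, hm⟩ := exists_pow_smul_mem (r := r) (n := n)
  let f : WordSpace r n →ₗ[ℂ[X]] modelLattice r n :=
    LinearMap.codRestrict _ ((Polynomial.X ^ m : ℂ[X]) • LinearMap.id) hm
  refine LinearMap.finrank_le_finrank_of_injective (f := f) fun φ ψ h => ?_
  have h2 : (Polynomial.X ^ m : ℂ[X]) • φ = (Polynomial.X ^ m : ℂ[X]) • ψ :=
    congrArg Subtype.val h
  exact smul_right_injective _ (pow_ne_zero m Polynomial.X_ne_zero) h2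

/-- The value at `t = 0` of the coordinates with respect to a basis of the lattice. -/
noncomputable def coordAtZero {ι : Type*} (b : Module.Basis ι ℂ[X] (modelLattice r n)) :
    modelLattice r n →ₗ[ℂ] ι → ℂ :=
  LinearMap.pi fun i => (Polynomial.aeval (0 : ℂ)).toLinearMap.comp
    ((b.coord i).restrictScalars ℂ)

theorem coordAtZero_apply {ι : Type*} (b : Module.Basis ι ℂ[X] (modelLattice r n))
    (φ : modelLattice r n) (i : ι) : coordAtZero b φ i = (b.repr φ i).eval 0 := by
  change Polynomial.aeval (0 : ℂ) (b.repr φ i) = _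
  rw [Polynomial.coe_aeval_eq_eval]

theorem coordAtZero_smul {ι : Type*} (b : Module.Basis ι ℂ[X] (modelLattice r n)) (p : ℂ[X])
    (φ : modelLattice r n) : coordAtZero b (p • φ) = p.eval 0 • coordAtZero b φ := by
  ext i
  rw [coordAtZero_apply, Pi.smul_apply, coordAtZero_apply, map_smul, Finsupp.smul_apply,
    smul_eq_mul, Polynomial.eval_mul, smul_eq_mul]

theorem coordAtZero_eq_zero {ι : Type*} [Finite ι] (b : Module.Basis ι ℂ[X] (modelLattice r n))
    (φ : modelLattice r n) : coordAtZero b φ = 0 ↔ ∃ ψ, φ = (Polynomial.X : ℂ[X]) • ψ := by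
  constructor
  · intro h
    have hdvd : ∀ i, (Polynomial.X : ℂ[X]) ∣ b.repr φ i := fun i => by
      rw [Polynomial.X_dvd_iff, Polynomial.coeff_zero_eq_eval_zero, ← coordAtZero_apply, h,
        Pi.zero_apply]
    choose q hq using hdvd
    refine ⟨b.equivFun.symm q, b.equivFun.injective ?_⟩
    rw [map_smul, LinearEquiv.apply_symm_apply]
    ext1 i
    rw [Module.Basis.equivFun_apply, hq, Pi.smul_apply, smul_eq_mul]
  · rintro ⟨ψ, rfl⟩
    rw [coordAtZero_smul, Polynomial.eval_X, zero_smul]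

/-- The action of the enveloping algebra on the highest weight vector of the model. -/
noncomputable def modelOrbit (r n : ℕ) : Env r ℂ[X] →ₗ[ℂ] modelLattice r n where
  toFun u := ⟨modelEnv r n u (modelVec r n), modelEnv_mem_modelLattice u⟩
  map_add' u u' := Subtype.ext (LinearMap.congr_fun (map_add (modelEnv r n) u u') _)
  map_smul' c u := Subtype.ext (LinearMap.congr_fun (map_smul (modelEnv r n) c u) _)

/-- The lattice is spanned over `ℂ[t]` by the orbit of the enveloping algebra, and modulo `t` a
coefficient `p(t)` acts as the number `p(0)`. -/
theorem coordAtZero_modelOrbit_surjective {ι : Type*} [Finite ι]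
    (b : Module.Basis ι ℂ[X] (modelLattice r n)) :
    Function.Surjective ((coordAtZero b).comp (modelOrbit r n)) := by
  intro c
  have hlat : ∀ φ (hφ : φ ∈ modelLattice r n),
      ∃ u, coordAtZero b (modelOrbit r n u) = coordAtZero b ⟨φ, hφ⟩ := by
    intro φ hφ
    induction hφ using Submodule.span_induction with
    | mem φ h =>
      obtain ⟨u, rfl⟩ := h
      exact ⟨u, rfl⟩
    | zero =>
      refine ⟨0, ?_⟩
      rw [map_zero]
      rfl
    | add φ ψ hφ hψ h h' =>
      obtain ⟨u, hu⟩ := h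
      obtain ⟨u', hu'⟩ := h'
      refine ⟨u + u', ?_⟩
      rw [map_add, map_add, hu, hu', ← map_add]
      rfl
    | smul p φ hφ h =>
      obtain ⟨u, hu⟩ := h
      refine ⟨p.eval 0 • u, ?_⟩
      rw [map_smul, map_smul, hu, ← coordAtZero_smul]
      rfl
  have hc : coordAtZero b (b.equivFun.symm fun i => Polynomial.C (c i)) = c := by
    ext i
    rw [coordAtZero_apply, ← Module.Basis.equivFun_apply, LinearEquiv.apply_symm_apply,
      Polynomial.eval_C]
  obtain ⟨u, hu⟩ := hlat _ (b.equivFun.symm fun i => Polynomial.C (c i)).2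
  exact ⟨u, hu.trans hc⟩

theorem modelIdeal_restrictScalars {ι : Type*} [Finite ι]
    (b : Module.Basis ι ℂ[X] (modelLattice r n)) :
    (modelIdeal r n).restrictScalars ℂ = LinearMap.ker ((coordAtZero b).comp (modelOrbit r n)) := by
  ext u
  rw [LinearMap.mem_ker, LinearMap.comp_apply, coordAtZero_eq_zero, Submodule.restrictScalars_mem,
    mem_modelIdeal]
  constructor
  · rintro ⟨φ, hφ, h⟩
    exact ⟨⟨φ, hφ⟩, Subtype.ext h⟩
  · rintro ⟨ψ, h⟩
    exact ⟨ψ.1, ψ.2, congrArg Subtype.val h⟩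

theorem exists_equiv_cyclic_modelIdeal :
    Nonempty (Cyclic (modelIdeal r n) ≃ₗ[ℂ] (Fin ((r + 1) ^ n) → ℂ)) := by
  let b := (Module.finBasisOfFinrankEq ℂ[X] (modelLattice r n) finrank_modelLattice)
  exact ⟨(Submodule.Quotient.restrictScalarsEquiv ℂ (modelIdeal r n)).symm.trans
    ((Submodule.quotEquivOfEq _ _ (modelIdeal_restrictScalars b)).trans
      (LinearMap.quotKerEquivOfSurjective _ (coordAtZero_modelOrbit_surjective b)))⟩

theorem finiteDimensional_cyclic_modelIdeal :
    FiniteDimensional ℂ (Cyclic (modelIdeal r n)) :=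
  let ⟨e⟩ := exists_equiv_cyclic_modelIdeal (r := r) (n := n)
  Module.Finite.equiv e.symm

theorem finrank_cyclic_modelIdeal :
    Module.finrank ℂ (Cyclic (modelIdeal r n)) = (r + 1) ^ n := by
  obtain ⟨e⟩ := exists_equiv_cyclic_modelIdeal (r := r) (n := n)
  rw [e.finrank_eq, Module.finrank_fin_fun]

end LatticeRank

/-! ### Identification of the local Weyl module with the model. -/

section LocalWeyl

variable {r n : ℕ}

theorem isHighestWeight_modelIdeal : IsHighestWeight (Cyclic (modelIdeal r n)) (origin r n)
    (Cyclic.vec (modelIdeal r n)) :=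
  have := finiteDimensional_cyclic_modelIdeal (r := r) (n := n)
  isHighestWeightIdeal_modelIdeal.isHighestWeight

/-- The intersection of the two ideals is again admissible, so its quotient has dimension at most
`(r+1)^n`. The model quotient already has this dimension, which forces the intersection to be the
model ideal. -/
theorem modelIdeal_le (hr : 1 ≤ r) {J : Ideal (Env r ℂ[X])}
    (hJ : IsHighestWeight (Cyclic J) (origin r n) (Cyclic.vec J)) : modelIdeal r n ≤ J := by
  have h1 := hJ.finiteDimensional hr
  have h2 := finiteDimensional_cyclic_modelIdeal (r := r) (n := n)
  have h3 : FiniteDimensional ℂ (Cyclic (modelIdeal r n ⊓ J)) := Cyclic.finiteDimensional_inf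
  have h4 := (isHighestWeightIdeal_modelIdeal.inf hJ.isHighestWeightIdeal).isHighestWeight
  refine Cyclic.le_of_finrank_inf_le ?_
  rw [finrank_cyclic_modelIdeal]
  exact h4.finrank_le hr

theorem localWeylIdeal_origin (hr : 1 ≤ r) : localWeylIdeal (origin r n) = modelIdeal r n :=
  le_antisymm (sInf_le isHighestWeight_modelIdeal) (le_sInf fun _ hJ => modelIdeal_le hr hJ)

theorem isHighestWeight_localWeyl (hr : 1 ≤ r) :
    IsHighestWeight (LocalWeyl (origin r n)) (origin r n) (LocalWeyl.vec (origin r n)) := by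
  unfold LocalWeyl LocalWeyl.vec
  rw [localWeylIdeal_origin hr]
  exact isHighestWeight_modelIdeal

theorem finrank_localWeyl (hr : 1 ≤ r) :
    Module.finrank ℂ (LocalWeyl (origin r n)) = (r + 1) ^ n := by
  unfold LocalWeyl
  rw [localWeylIdeal_origin hr, finrank_cyclic_modelIdeal]

theorem isLocalWeylModule_origin (hr : 1 ≤ r) :
    IsLocalWeylModule.{u} (origin r n) (LocalWeyl (origin r n)) (LocalWeyl.vec (origin r n)) where
  isHighestWeight := isHighestWeight_localWeyl hr
  maximal V _ _ _ _ v hv := by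
    have h1 := hv.finiteDimensional hr
    -- A module in an arbitrary universe is compared with `W` through the annihilator of its
    -- generator, which is one of the ideals in the intersection.
    have h2 : FiniteDimensional ℂ (Cyclic (annihilatorIdeal r ℂ[X] v)) :=
      Module.Finite.of_injective (Cyclic.lift (le_refl (annihilatorIdeal r ℂ[X] v))).toLinearMap
        (Cyclic.lift_injective v)
    have hle : localWeylIdeal (origin r n) ≤ annihilatorIdeal r ℂ[X] v :=
      sInf_le (IsHighestWeight.annihilatorIdeal v hv).isHighestWeight
    exact ⟨Cyclic.lift hle, Cyclic.lift_surjective v hle hv.generates, Cyclic.lift_vec v hle⟩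

/-! ### Dimensions of the weight spaces. -/

section WeightDimensions

variable {V : Type*} [AddCommGroup V] [Module ℂ V]
  [LieRingModule (Current r ℂ[X]) V] [LieModule ℂ (Current r ℂ[X]) V] {v : V}

/-- The weight of the symmetrized tensors with given multiplicities of the basis vectors. -/
def multiplicityWeight (ν : Fin (r + 1) → ℕ) (j : Fin r) : ℤ := (ν j.castSucc : ℤ) - ν j.succ

/-- Equal consecutive differences make `ν - ν'` constant, and equal sums make the constant zero. -/
theorem multiplicityWeight_injOn : Set.InjOn (multiplicityWeight (r := r)) {ν | ∑ c, ν c = n} := by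
  intro ν hν ν' hν' h
  have hdiff : ∀ c : Fin (r + 1), (ν c : ℤ) - ν' c = (ν 0 : ℤ) - ν' 0 := by
    intro c
    induction c using Fin.induction with
    | zero => rfl
    | succ j ih =>
      have := congrFun h j
      unfold multiplicityWeight at this
      omega
  have hsum : ∑ c, ((ν c : ℤ) - ν' c) = 0 := by
    rw [Finset.sum_sub_distrib, ← Nat.cast_sum, ← Nat.cast_sum, hν, hν', sub_self]
  rw [Finset.sum_congr rfl fun c _ => hdiff c, Finset.sum_const, Finset.card_univ,
    Fintype.card_fin, nsmul_eq_mul] at hsum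
  have h0 := (mul_eq_zero.1 hsum).resolve_left (by positivity)
  ext c
  have := hdiff c
  omega

theorem IsHighestWeight.cartanOrbit_le_weightSpace (hr : 1 ≤ r)
    (hv : IsHighestWeight V (origin r n) v) {ν : Fin (r + 1) → ℕ} (hν : ∑ c, ν c = n) :
    cartanOrbit (unitAction (r := r) n V) (dividedVector (r := r) n v ν) ≤
      weightSpace r ℂ[X] V (multiplicityWeight ν) := by
  intro y hy j
  have h := (hv.isSymmetricFamily hr).diag_one_apply hν
  rw [← unitAction_coroot n, h _ hy, h _ hy, ← sub_smul, multiplicityWeight]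
  push_cast
  rfl

/-- The orbits span the module and lie in weight spaces of distinct weights. Since weight spaces are
independent, each of these weight spaces is exactly its orbit. -/
theorem IsHighestWeight.weightSpace_eq_cartanOrbit (hr : 1 ≤ r)
    (hv : IsHighestWeight V (origin r n) v) {ν : Fin (r + 1) → ℕ} (hν : ∑ c, ν c = n) :
    weightSpace r ℂ[X] V (multiplicityWeight ν) =
      cartanOrbit (unitAction (r := r) n V) (dividedVector (r := r) n v ν) := by
  refine le_antisymm ?_ (hv.cartanOrbit_le_weightSpace hr hν)
  have hdis := iSupIndep_weightSpace (r := r) (V := V) (multiplicityWeight ν)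
  have htop : cartanOrbit (unitAction (r := r) n V) (dividedVector (r := r) n v ν) ⊔
      (⨆ (μ) (_ : μ ≠ multiplicityWeight ν), weightSpace r ℂ[X] V μ) = ⊤ := by
    rw [eq_top_iff, ← hv.iSup_cartanOrbit_eq_top hr]
    refine iSup₂_le fun ν' hν' => ?_
    have hν' : ∑ c, ν' c = n := by simpa using hν'
    by_cases h : ν' = ν
    · rw [h]
      exact le_sup_left
    · refine le_sup_of_le_right (le_iSup₂_of_le (multiplicityWeight ν') (fun h' => h ?_)
        (hv.cartanOrbit_le_weightSpace hr hν'))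
      exact multiplicityWeight_injOn hν' hν h'
  intro y hy
  obtain ⟨x, hx, z, hz, rfl⟩ := Submodule.mem_sup.1 (htop ▸ Submodule.mem_top (x := y))
  have hz' : z ∈ weightSpace r ℂ[X] V (multiplicityWeight ν) := by
    have := sub_mem hy (hv.cartanOrbit_le_weightSpace hr hν hx)
    rwa [add_sub_cancel_left] at this
  rw [(Submodule.disjoint_def.1 hdis) z hz' hz, add_zero]
  exact hx

theorem IsHighestWeight.finrank_weightSpace (hr : 1 ≤ r)
    (hv : IsHighestWeight V (origin r n) v) (hdim : Module.finrank ℂ V = (r + 1) ^ n)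
    {ν : Fin (r + 1) → ℕ} (hν : ∑ c, ν c = n) :
    Module.finrank ℂ (weightSpace r ℂ[X] V (multiplicityWeight ν)) =
      Nat.multinomial Finset.univ ν := by
  have : Nontrivial (Fin (r + 1)) := Fin.nontrivial_iff_two_le.2 (by omega)
  rw [hv.weightSpace_eq_cartanOrbit hr hν]
  exact (hv.isSymmetricFamily hr).finrank_cartanOrbit_eq (hv.iSup_cartanOrbit_eq_top hr)
    (by rw [hdim, Fintype.card_fin]) hν

end WeightDimensions

end LocalWeyl

end WeylModule

theorem mainTheorem10 (r n : ℕ) (hr : 1 ≤ r) :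
    WeylModule.IsLocalWeylModule.{u} (WeylModule.origin r n)
      (WeylModule.LocalWeyl (WeylModule.origin r n))
      (WeylModule.LocalWeyl.vec (WeylModule.origin r n)) ∧
    FiniteDimensional ℂ (WeylModule.LocalWeyl (WeylModule.origin r n)) ∧
    Module.finrank ℂ (WeylModule.LocalWeyl (WeylModule.origin r n)) = (r + 1) ^ n ∧
    ∀ i : Fin (r + 1) → ℕ, ∑ j, i j = n →
      Module.finrank ℂ
        (WeylModule.weightSpace r ℂ[X] (WeylModule.LocalWeyl (WeylModule.origin r n))
          fun j : Fin r => (i j.castSucc : ℤ) - (i j.succ : ℤ)) =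
      Nat.multinomial Finset.univ i := by
  have hW := WeylModule.isHighestWeight_localWeyl (n := n) hr
  exact ⟨WeylModule.isLocalWeylModule_origin hr, hW.finiteDimensional hr,
    WeylModule.finrank_localWeyl hr,
    fun i hi => hW.finrank_weightSpace hr (WeylModule.finrank_localWeyl hr) hi⟩
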